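/- Let $V:\mathbb R\to\mathbb R$ be $C^2$, let $c\in\mathbb R$ with $c^2>1$, and let $u(x,t)=f(x-ct)$ be a periodic traveling wave of the Klein--Gordon equation $u_{tt}-u_{xx}+V'(u)=0$, that is, a classical solution for which $f'$ is periodic with fundamental period $T>0$. Let $\sigma\subset\mathbb C$ be the set of $\lambda$ for which $$(c^2-1)w''-2c\lambda w'+(\lambda^2+V''(f(z)))w=0$$ has a nontrivial solution $w:\mathbb R\to\mathbb C$ that is bounded on $\mathbb R$. The wave is said to exhibit a dynamical Hamiltonian--Hopf instability at a nonzero $\lambda\in i\mathbb R$ if every neighborhood of $\lambda$ contains a point of $\sigma\setminus i\mathbb R$. Let $\Sigma^{\mathrm H}\subset\mathbb R$ be the spectrum of Hill's equation $y''+P(z)y=\nu y$ with $P(z)=V''(f(z))/(c^2-1)$, that is, the set of $\nu\in\mathbb C$ for which its monodromy matrix over $[0,T]$ has an eigenvalue of modulus one. The bands are the connected components of $\Sigma^{\mathrm H}$, and the open gaps are the nonempty bounded intervals $(\alpha,\beta)$ that are disjoint from $\Sigma^{\mathrm H}$ and have $\alpha,\beta\in\Sigma^{\mathrm H}$. Write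 $\nu(\lambda)=(\lambda/(c^2-1))^2$. Then there is a number $N$, depending on the wave, such that to every open gap $(\alpha,\beta)$ with $\beta<-N$ one can assign two points $\lambda$ on the positive imaginary axis at which the wave exhibits a dynamical Hamiltonian--Hopf instability, one with $\nu(\lambda)$ in the band having $\alpha$ as its right endpoint and the other with $\nu(\lambda)$ in the band having $\beta$ as its left endpoint. All of these points, two for each such gap, are pairwise distinct (also for different gaps). -/

import Mathlib

open Set Topology

/-- `u = u(x,t)` is a classical solution of the Klein-Gordon equation `u_tt - u_xx + V'(u) = 0`
on the whole plane. -/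
def IsKleinGordonSolution (V : ℝ → ℝ) (u : ℝ → ℝ → ℝ) : Prop :=
  ContDiff ℝ 2 (fun p : ℝ × ℝ => u p.1 p.2) ∧
  ∀ x t : ℝ, deriv (deriv fun s => u x s) t - deriv (deriv fun y => u y t) x
    + deriv V (u x t) = 0

/-- `T` is the fundamental (that is, smallest positive) period of `g`. -/
def IsFundamentalPeriod (g : ℝ → ℝ) (T : ℝ) : Prop :=
  0 < T ∧ Function.Periodic g T ∧ ∀ S : ℝ, 0 < S → Function.Periodic g S → T ≤ S

/-- `u(x,t) = f(x - c t)` is a periodic traveling wave: it solves the Klein-Gordon equation, and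
`f'` (not necessarily `f`) is periodic with fundamental period `T`. -/
structure IsPeriodicTravelingWave (V : ℝ → ℝ) (c : ℝ) (f : ℝ → ℝ) (T : ℝ) : Prop where
  speed : c ^ 2 ≠ 1
  solution : IsKleinGordonSolution V (fun x t => f (x - c * t))
  period : IsFundamentalPeriod (deriv f) T

/-- `w` is twice differentiable and solves the linearized spectral problem
`(c² - 1) w'' - 2 c λ w' + (λ² + V''(f)) w = 0` on the whole line. -/
def IsSpectralSolution (V : ℝ → ℝ) (c : ℝ) (f : ℝ → ℝ) (lam : ℂ) (w : ℝ → ℂ) : Prop :=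
  Differentiable ℝ w ∧ Differentiable ℝ (deriv w) ∧
  ∀ z : ℝ, ((c : ℂ) ^ 2 - 1) * deriv (deriv w) z - 2 * (c : ℂ) * lam * deriv w z
    + (lam ^ 2 + ((deriv (deriv V) (f z) : ℝ) : ℂ)) * w z = 0

/-- The (Floquet) spectrum `σ`: the `λ` for which there is a nontrivial bounded solution. -/
def floquetSpectrum (V : ℝ → ℝ) (c : ℝ) (f : ℝ → ℝ) : Set ℂ :=
  {lam | ∃ w : ℝ → ℂ, IsSpectralSolution V c f lam w ∧ (∃ z, w z ≠ 0) ∧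
    ∃ B : ℝ, ∀ z, ‖w z‖ ≤ B}

/-- Dynamical Hamiltonian-Hopf instability at `λ`: `λ` is a nonzero imaginary number, every
neighborhood of which meets the non-imaginary part of `σ`. -/
def IsDynamicalHamiltonianHopf (V : ℝ → ℝ) (c : ℝ) (f : ℝ → ℝ) (lam : ℂ) : Prop :=
  lam ≠ 0 ∧ lam.re = 0 ∧
  ∀ U ∈ 𝓝 lam, ((floquetSpectrum V c f ∩ U) \ {z : ℂ | z.re = 0}).Nonempty

/-- The potential `P(z) = V''(f(z)) / (c² - 1)` of the associated Hill equation. -/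
noncomputable def hillPotential (V : ℝ → ℝ) (c : ℝ) (f : ℝ → ℝ) (z : ℝ) : ℝ :=
  deriv (deriv V) (f z) / (c ^ 2 - 1)

/-- The Hill spectral parameter `ν(λ) = (λ / (c² - 1))²`. -/
noncomputable def hillParameter (c : ℝ) (lam : ℂ) : ℂ :=
  (lam / ((c : ℂ) ^ 2 - 1)) ^ 2

/-- `y` is twice differentiable and solves Hill's equation `y'' + P y = ν y` on the whole line. -/
def IsHillSolution (P : ℝ → ℝ) (nu : ℂ) (y : ℝ → ℂ) : Prop :=
  Differentiable ℝ y ∧ Differentiable ℝ (deriv y) ∧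
  ∀ z : ℝ, deriv (deriv y) z + (P z : ℂ) * y z = nu * y z

/-- `μ` is an eigenvalue of the monodromy matrix of Hill's equation, built from the solutions
`y₁`, `y₂` with `y₁(0) = y₂'(0) = 1` and `y₁'(0) = y₂(0) = 0`. -/
def IsHillMultiplier (P : ℝ → ℝ) (T : ℝ) (nu μ : ℂ) : Prop :=
  ∃ y₁ y₂ : ℝ → ℂ, IsHillSolution P nu y₁ ∧ IsHillSolution P nu y₂ ∧
    y₁ 0 = 1 ∧ deriv y₁ 0 = 0 ∧ y₂ 0 = 0 ∧ deriv y₂ 0 = 1 ∧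
    Module.End.HasEigenvalue
      (Matrix.toLin' !![y₁ T, y₂ T; deriv y₁ T, deriv y₂ T]) μ

/-- The Hill spectrum: the `ν` for which some multiplier has unit modulus. -/
def hillSpectrum (P : ℝ → ℝ) (T : ℝ) : Set ℂ :=
  {nu | ∃ μ : ℂ, IsHillMultiplier P T nu μ ∧ ‖μ‖ = 1}

/-- The interval `(g.1, g.2)` is a (bounded, nonempty) open gap of the set `S`, which is meant to
be contained in the real axis: it misses `S`, and both of its endpoints belong to `S`. -/
def IsOpenGap (S : Set ℂ) (g : ℝ × ℝ) : Prop :=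
  g.1 < g.2 ∧ (g.1 : ℂ) ∈ S ∧ (g.2 : ℂ) ∈ S ∧ ∀ x ∈ Ioo g.1 g.2, (x : ℂ) ∉ S

/-- The band of `S` containing the point `x` of `S`: its connected component. -/
def band (S : Set ℂ) (x : ℝ) : Set ℂ :=
  connectedComponentIn S (x : ℂ)

/-! Put λ = i(c² - 1)ω and w = e^{icωz} y. The linearized equation becomes Hill's equation for y
with ν = -ω², and w is bounded if e^{icωT}ρ has modulus one, where ρ is the multiplier of y. The
monodromy matrix has determinant 1; if D(ω) is its trace, then λ ∈ σ as soon as 2cos(θ - cTω) = D(ω)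
for some real θ (`IsHillSystem.mem_floquetSpectrum`).

Inside a band write D = 2cos φ. Then θ = φ + cTω is locally an analytic function of ω that is real
on the real axis. At a critical point such a function takes real values at nonreal points
arbitrarily close by (`exists_nonreal_of_deriv_eq_zero`), and these give points of σ off the
imaginary axis. Up to the sign of φ, the condition φ' = -cT says D'² = c²T²(4 - D²).

Solutions of this equation come from the intermediate value theorem for G = D'² - c²T²(4 - D²)
(`IsNearCosine.exists_critical`). At an end of an open gap D² = 4 and, at high frequency, D' ≠ 0, so
G > 0. Further inside the adjacent band D is C²-close to 2cos(ωT), hence D'² ≈ T²(4 - D²), and c² >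
1 makes G < 0.

The closeness is proved in a complex strip by variation of constants and Gronwall, and passes to
derivatives by Cauchy estimates; analyticity in ν comes from a weighted Volterra equation. Near nπ/T
the function (-1)ⁿD is strictly concave, so this arch contains at most one gap and D' does not
vanish at its ends. Arches are disjoint, which separates the points of different gaps. -/

open BoundedContinuousFunction

/-! ### A weighted Volterra operator -/

/-- The weight `1 / cosh (κ z)` as a bounded continuous function. -/
noncomputable def sechWeight (κ : ℝ) : ℝ →ᵇ ℂ :=
  BoundedContinuousFunction.ofNormedAddCommGroup (fun z => ((Real.cosh (κ * z))⁻¹ : ℂ))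
    (by
      have h : ∀ z : ℝ, (Real.cosh (κ * z) : ℂ) ≠ 0 := fun z => by
        exact_mod_cast (Real.cosh_pos _).ne'
      exact Continuous.inv₀ (by fun_prop) h) 1
    (fun z => by
      rw [norm_inv, Complex.norm_real, Real.norm_of_nonneg (Real.cosh_pos _).le]
      exact inv_le_one_of_one_le₀ (Real.one_le_cosh _))

theorem continuous_cosh_mul (κ : ℝ) (U : ℝ →ᵇ ℂ) :
    Continuous fun t : ℝ => (Real.cosh (κ * t) : ℂ) * U t := by
  have := U.continuous
  fun_prop

/-- The integral of cosh(κt) is sinh(κz)/κ, bounded by cosh(κz)/κ: in the cosh-weighted norm,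
integration gains a factor 1/κ on the whole line. -/
theorem norm_integral_cosh_mul_le {κ : ℝ} (hκ : 0 < κ) (U : ℝ →ᵇ ℂ) (z : ℝ) :
    ‖∫ t in (0 : ℝ)..z, (Real.cosh (κ * t) : ℂ) * U t‖ ≤ Real.cosh (κ * z) * (‖U‖ / κ) := by
  have hi : ∫ t in (0 : ℝ)..z, Real.cosh (κ * t) * ‖U‖ = Real.sinh (κ * z) / κ * ‖U‖ := by
    have hd : ∀ t ∈ uIcc 0 z,
        HasDerivAt (fun t => Real.sinh (κ * t) / κ * ‖U‖) (Real.cosh (κ * t) * ‖U‖) t := by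
      intro t _
      have h := (((Real.hasDerivAt_sinh (κ * t)).comp t
        ((hasDerivAt_id t).const_mul κ)).div_const κ).mul_const ‖U‖
      refine h.congr_deriv ?_
      field_simp
    rw [intervalIntegral.integral_eq_sub_of_hasDerivAt hd
      (Continuous.intervalIntegrable (by fun_prop) _ _)]
    simp
  have h := intervalIntegral.norm_integral_le_abs_of_norm_le
    (μ := MeasureTheory.volume) (a := 0) (b := z)
    (f := fun t => (Real.cosh (κ * t) : ℂ) * U t) (g := fun t => Real.cosh (κ * t) * ‖U‖)
    (Filter.Eventually.of_forall fun t => by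
      rw [norm_mul, Complex.norm_real, Real.norm_of_nonneg (Real.cosh_pos _).le]
      exact mul_le_mul_of_nonneg_left (U.norm_coe_le_norm t) (Real.cosh_pos _).le)
    (Continuous.intervalIntegrable (by fun_prop) _ _)
  refine h.trans ?_
  rw [hi, abs_mul, abs_div, abs_of_pos hκ, abs_of_nonneg (norm_nonneg U), div_mul_eq_mul_div,
    ← mul_div_assoc]
  have hs : |Real.sinh (κ * z)| ≤ Real.cosh (κ * z) := by
    rw [Real.abs_sinh, ← Real.cosh_abs (κ * z)]
    exact (Real.sinh_lt_cosh _).le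
  gcongr

theorem norm_sechWeight_mul_integral_le {κ : ℝ} (hκ : 0 < κ) (U : ℝ →ᵇ ℂ) (z : ℝ) :
    ‖sechWeight κ z * ∫ t in (0 : ℝ)..z, (Real.cosh (κ * t) : ℂ) * U t‖ ≤ ‖U‖ / κ := by
  have hc := Real.cosh_pos (κ * z)
  have h : ‖sechWeight κ z‖ = (Real.cosh (κ * z))⁻¹ := by
    change ‖((Real.cosh (κ * z))⁻¹ : ℂ)‖ = _
    rw [norm_inv, Complex.norm_real, Real.norm_of_nonneg hc.le]
  rw [norm_mul, h, inv_mul_le_iff₀ hc]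
  exact norm_integral_cosh_mul_le hκ U z

/-- The operator `U ↦ (z ↦ (1 / cosh (κ z)) ∫₀ᶻ cosh (κ t) U(t) dt)`. -/
noncomputable def volterra (κ : ℝ) (hκ : 0 < κ) : (ℝ →ᵇ ℂ) →L[ℂ] (ℝ →ᵇ ℂ) :=
  LinearMap.mkContinuous
    { toFun := fun U => BoundedContinuousFunction.ofNormedAddCommGroup
        (fun z => sechWeight κ z * ∫ t in (0 : ℝ)..z, (Real.cosh (κ * t) : ℂ) * U t)
        ((sechWeight κ).continuous.mul (intervalIntegral.continuous_primitive
          (fun a b => (continuous_cosh_mul κ U).intervalIntegrable a b) 0))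
        (‖U‖ / κ)
        (norm_sechWeight_mul_integral_le hκ U)
      map_add' := fun U W => by
        ext z
        simp only [BoundedContinuousFunction.coe_ofNormedAddCommGroup,
          BoundedContinuousFunction.coe_add, Pi.add_apply, mul_add]
        rw [intervalIntegral.integral_add
          ((continuous_cosh_mul κ U).intervalIntegrable _ _)
          ((continuous_cosh_mul κ W).intervalIntegrable _ _), mul_add]
      map_smul' := fun a U => by
        ext z
        simp only [BoundedContinuousFunction.coe_ofNormedAddCommGroup,
          BoundedContinuousFunction.coe_smul, smul_eq_mul, RingHom.id_apply, mul_left_comm _ a]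
        rw [intervalIntegral.integral_const_mul]
        ring }
    κ⁻¹ (fun U => by
      rw [inv_mul_eq_div]
      exact BoundedContinuousFunction.norm_ofNormedAddCommGroup_le _ (by positivity)
        (norm_sechWeight_mul_integral_le hκ U))

theorem cosh_mul_volterra {κ : ℝ} (hκ : 0 < κ) (U : ℝ →ᵇ ℂ) (z : ℝ) :
    (Real.cosh (κ * z) : ℂ) * volterra κ hκ U z
      = ∫ t in (0 : ℝ)..z, (Real.cosh (κ * t) : ℂ) * U t := by
  have h : (Real.cosh (κ * z) : ℂ) ≠ 0 := by exact_mod_cast (Real.cosh_pos _).ne'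
  change (Real.cosh (κ * z) : ℂ) * ((Real.cosh (κ * z) : ℂ)⁻¹ * _) = _
  rw [mul_inv_cancel_left₀ h]

theorem norm_volterra_le {κ : ℝ} (hκ : 0 < κ) : ‖volterra κ hκ‖ ≤ κ⁻¹ :=
  LinearMap.mkContinuous_norm_le _ (by positivity) _

theorem hasDerivAt_cosh_mul_volterra {κ : ℝ} (hκ : 0 < κ) (U : ℝ →ᵇ ℂ) (z : ℝ) :
    HasDerivAt (fun z : ℝ => (Real.cosh (κ * z) : ℂ) * volterra κ hκ U z)
      ((Real.cosh (κ * z) : ℂ) * U z) z := by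
  simp only [cosh_mul_volterra]
  exact ((continuous_cosh_mul κ U).integral_hasStrictDerivAt 0 z).hasDerivAt

/-! ### Solutions of Hill's equation -/

theorem IsHillSolution.hasDerivAt {P : ℝ → ℝ} {nu : ℂ} {y : ℝ → ℂ} (h : IsHillSolution P nu y)
    (z : ℝ) : HasDerivAt y (deriv y z) z :=
  (h.1 z).hasDerivAt

theorem IsHillSolution.hasDerivAt_deriv {P : ℝ → ℝ} {nu : ℂ} {y : ℝ → ℂ}
    (h : IsHillSolution P nu y) (z : ℝ) :
    HasDerivAt (deriv y) ((nu - P z) * y z) z := by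
  have := (h.2.1 z).hasDerivAt
  rwa [show deriv (deriv y) z = (nu - P z) * y z by linear_combination h.2.2 z] at this

theorem isHillSolution_of_hasDerivAt {P : ℝ → ℝ} {nu : ℂ} {y v : ℝ → ℂ}
    (hy : ∀ z, HasDerivAt y (v z) z) (hv : ∀ z, HasDerivAt v ((nu - P z) * y z) z) :
    IsHillSolution P nu y ∧ deriv y = v := by
  have h : deriv y = v := funext fun z => (hy z).deriv
  refine ⟨⟨fun z => (hy z).differentiableAt, ?_, fun z => ?_⟩, h⟩
  · rw [h]; exact fun z => (hv z).differentiableAt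
  · rw [h, (hv z).deriv]; ring

theorem exists_differentiable_inverse_one_sub {A : Type*} [NormedRing A] [NormedAlgebra ℂ A]
    [CompleteSpace A] (K : ℂ → A) (s : Set ℂ) (hK : ∀ x ∈ s, ‖K x‖ < 1)
    (hd : ∀ x ∈ s, DifferentiableAt ℂ K x) :
    ∃ B : ℂ → A, ∀ x ∈ s, (1 - K x) * B x = 1 ∧ DifferentiableAt ℂ B x :=
  ⟨fun x => Ring.inverse (1 - K x), fun x hx =>
    ⟨Ring.mul_inverse_cancel _ (isUnit_one_sub_of_norm_lt_one (hK x hx)),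
      DifferentiableAt.fun_comp' x
        (differentiableAt_inverse (isUnit_one_sub_of_norm_lt_one (hK x hx)))
        ((hd x hx).const_sub 1)⟩⟩

/-- The solution satisfies y = a + bz + ∬(ν - P)y. Divided by cosh(κz), with J = `volterra κ` and E
= 1/cosh(κz), this is U = aE + bJE + J²(qU) with q = ν - P, an equation in bounded continuous
functions. For large κ the operator K(ν) = J²q is a contraction, affine in ν, so (1 - K(ν))⁻¹ and
with it y and y' at each point are analytic in ν. -/
theorem exists_hillSolution_family (P : ℝ → ℝ) (hP : Continuous P) {M : ℝ} (hM : ∀ z, |P z| ≤ M)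
    (R : ℝ) (hR : 0 < R) (a b : ℂ) :
    ∃ y : ℂ → ℝ → ℂ, ∀ nu ∈ Metric.ball (0 : ℂ) R,
      IsHillSolution P nu (y nu) ∧ y nu 0 = a ∧ deriv (y nu) 0 = b ∧
      ∀ z, DifferentiableAt ℂ (fun nu => y nu z) nu ∧
        DifferentiableAt ℂ (fun nu => deriv (y nu) z) nu := by
  have hM0 : 0 ≤ M := (abs_nonneg _).trans (hM 0)
  let Pb : ℝ →ᵇ ℂ := BoundedContinuousFunction.ofNormedAddCommGroup (fun z => (P z : ℂ))
    (by fun_prop) M (fun z => by rw [Complex.norm_real]; exact hM z)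
  have hPb : ‖Pb‖ ≤ M := BoundedContinuousFunction.norm_ofNormedAddCommGroup_le _ hM0 _
  -- On the ball ‖q‖ < κ, and ‖J‖² ≤ κ⁻² ≤ κ⁻¹ because κ ≥ 1; hence ‖K‖ < 1.
  let κ : ℝ := R + M + 1
  have hκ1 : 1 ≤ κ := by simp only [κ]; linarith
  have hκ : 0 < κ := by linarith
  let J := volterra κ hκ
  let E := sechWeight κ
  let q : ℂ → (ℝ →ᵇ ℂ) := fun nu => nu • (1 : ℝ →ᵇ ℂ) - Pb
  have hq : ∀ nu ∈ Metric.ball (0 : ℂ) R, ‖q nu‖ < κ := by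
    intro nu hnu
    have h1 : ‖nu‖ < R := by simpa using hnu
    calc ‖q nu‖ ≤ ‖nu • (1 : ℝ →ᵇ ℂ)‖ + ‖Pb‖ := norm_sub_le _ _
      _ ≤ ‖nu‖ * 1 + M := by rw [norm_smul, norm_one]; gcongr
      _ < κ := by simp only [κ]; linarith
  let K : ℂ → ((ℝ →ᵇ ℂ) →L[ℂ] (ℝ →ᵇ ℂ)) := fun nu =>
    J * J * ContinuousLinearMap.mul ℂ (ℝ →ᵇ ℂ) (q nu)
  have hK : ∀ nu ∈ Metric.ball (0 : ℂ) R, ‖K nu‖ < 1 := by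
    intro nu hnu
    have hJ : ‖J‖ ≤ κ⁻¹ := norm_volterra_le hκ
    have h1 : κ⁻¹ ≤ 1 := inv_le_one_of_one_le₀ hκ1
    calc ‖K nu‖ ≤ ‖J * J‖ * ‖ContinuousLinearMap.mul ℂ (ℝ →ᵇ ℂ) (q nu)‖ := norm_mul_le _ _
      _ ≤ (‖J‖ * ‖J‖) * ‖q nu‖ := by
          gcongr
          · exact norm_mul_le _ _
          · exact ContinuousLinearMap.opNorm_mul_apply_le ℂ _ _
      _ ≤ (κ⁻¹ * 1) * ‖q nu‖ := by
          gcongr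
          exact hJ.trans h1
      _ < (κ⁻¹ * 1) * κ := by
          gcongr
          exact hq nu hnu
      _ = 1 := by field_simp
  have hKd : ∀ nu ∈ Metric.ball (0 : ℂ) R, DifferentiableAt ℂ K nu := by
    intro nu _
    have h2 : DifferentiableAt ℂ (fun nu => ContinuousLinearMap.mul ℂ (ℝ →ᵇ ℂ) (q nu)) nu :=
      (ContinuousLinearMap.mul ℂ (ℝ →ᵇ ℂ)).differentiableAt.fun_comp' nu
        ((differentiableAt_id.smul_const (1 : ℝ →ᵇ ℂ)).sub_const Pb)
    exact h2.const_mul (J * J)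
  obtain ⟨B, hB⟩ := exists_differentiable_inverse_one_sub K _ hK hKd
  let U : ℂ → (ℝ →ᵇ ℂ) := fun nu => B nu (a • E + b • J E)
  have hU : ∀ nu ∈ Metric.ball (0 : ℂ) R, U nu = a • E + b • J E + J (J (q nu * U nu)) := by
    intro nu hnu
    have h := congrArg (fun A : (ℝ →ᵇ ℂ) →L[ℂ] (ℝ →ᵇ ℂ) => A (a • E + b • J E)) (hB nu hnu).1
    change U nu - J (J (q nu * U nu)) = a • E + b • J E at h
    rw [← h]; abel
  have hUd : ∀ nu ∈ Metric.ball (0 : ℂ) R, DifferentiableAt ℂ U nu := fun nu hnu =>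
    (hB nu hnu).2.clm_apply (differentiableAt_const _)
  let y : ℂ → ℝ → ℂ := fun nu z => (Real.cosh (κ * z) : ℂ) * U nu z
  let v : ℂ → ℝ → ℂ := fun nu z => b + (Real.cosh (κ * z) : ℂ) * J (q nu * U nu) z
  have hE : ∀ z : ℝ, (Real.cosh (κ * z) : ℂ) * E z = 1 := fun z =>
    mul_inv_cancel₀ (by exact_mod_cast (Real.cosh_pos _).ne')
  have hyU : ∀ nu ∈ Metric.ball (0 : ℂ) R, y nu = fun z : ℝ => a
      + b * ((Real.cosh (κ * z) : ℂ) * J E z)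
      + (Real.cosh (κ * z) : ℂ) * J (J (q nu * U nu)) z := by
    intro nu hnu
    funext z
    have h := congrArg (fun W : ℝ →ᵇ ℂ => W z) (hU nu hnu)
    simp only [BoundedContinuousFunction.coe_add, BoundedContinuousFunction.coe_smul,
      Pi.add_apply, smul_eq_mul] at h
    simp only [y]
    rw [h]
    linear_combination a * hE z
  have hy : ∀ nu ∈ Metric.ball (0 : ℂ) R, ∀ z, HasDerivAt (y nu) (v nu z) z := by
    intro nu hnu z
    rw [hyU nu hnu]
    have h := (((hasDerivAt_cosh_mul_volterra hκ E z).const_mul b).const_add a).add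
      (hasDerivAt_cosh_mul_volterra hκ (J (q nu * U nu)) z)
    refine h.congr_deriv ?_
    rw [hE]
    simp only [v, J, mul_one]
  have hv : ∀ nu ∈ Metric.ball (0 : ℂ) R, ∀ z, HasDerivAt (v nu) ((nu - P z) * y nu z) z := by
    intro nu _ z
    refine ((hasDerivAt_cosh_mul_volterra hκ (q nu * U nu) z).const_add b).congr_deriv ?_
    have : q nu z = nu - P z := by
      change nu * 1 - (P z : ℂ) = _
      ring
    simp only [BoundedContinuousFunction.coe_mul, Pi.mul_apply, y]
    rw [this]; ring
  have hJ0 : ∀ W : ℝ →ᵇ ℂ, J W 0 = 0 := fun W => by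
    have := cosh_mul_volterra hκ W 0
    simpa using this
  have hev : ∀ (z : ℝ) (W : ℂ → (ℝ →ᵇ ℂ)) (nu : ℂ), DifferentiableAt ℂ W nu →
      DifferentiableAt ℂ (fun nu => W nu z) nu := fun z W nu hW =>
    (BoundedContinuousFunction.evalCLM ℂ z : (ℝ →ᵇ ℂ) →L[ℂ] ℂ).differentiableAt.fun_comp' nu hW
  refine ⟨y, fun nu hnu => ?_⟩
  obtain ⟨hs, hd⟩ := isHillSolution_of_hasDerivAt (P := P) (hy nu hnu) (hv nu hnu)
  refine ⟨hs, ?_, ?_, fun z => ⟨?_, ?_⟩⟩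
  · rw [hyU nu hnu]; simp [hJ0]
  · rw [hd]; simp [v, hJ0]
  · exact (hev z U nu (hUd nu hnu)).const_mul _
  · have h1 : DifferentiableAt ℂ (fun nu => v nu z) nu := by
      have hqd : DifferentiableAt ℂ q nu :=
        (differentiableAt_id.smul_const (1 : ℝ →ᵇ ℂ)).sub_const Pb
      have h2 : DifferentiableAt ℂ (fun nu => J (q nu * U nu)) nu :=
        J.differentiableAt.fun_comp' nu (hqd.mul (hUd nu hnu))
      exact ((hev z _ nu h2).const_mul _).const_add b
    refine h1.congr_of_eventuallyEq ?_
    filter_upwards [Metric.isOpen_ball.mem_nhds hnu] with nu' hnu'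
    exact congrFun (isHillSolution_of_hasDerivAt (P := P) (hy nu' hnu') (hv nu' hnu')).2 z

/-- `y₁ nu`, `y₂ nu` are the solutions of Hill's equation with the standard initial values. -/
structure IsHillSystem (P : ℝ → ℝ) (y₁ y₂ : ℂ → ℝ → ℂ) : Prop where
  sol₁ : ∀ nu, IsHillSolution P nu (y₁ nu)
  sol₂ : ∀ nu, IsHillSolution P nu (y₂ nu)
  init₁ : ∀ nu, y₁ nu 0 = 1
  deriv_init₁ : ∀ nu, deriv (y₁ nu) 0 = 0
  init₂ : ∀ nu, y₂ nu 0 = 0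
  deriv_init₂ : ∀ nu, deriv (y₂ nu) 0 = 1

theorem IsHillSolution.wronskian_eq {P : ℝ → ℝ} {nu : ℂ} {u y : ℝ → ℂ}
    (hu : IsHillSolution P nu u) (hy : IsHillSolution P nu y) (z : ℝ) :
    u z * deriv y z - deriv u z * y z = u 0 * deriv y 0 - deriv u 0 * y 0 := by
  have hd : ∀ z, HasDerivAt (fun z => u z * deriv y z - deriv u z * y z) 0 z := fun z => by
    refine (((hu.hasDerivAt z).mul (hy.hasDerivAt_deriv z)).sub
      ((hu.hasDerivAt_deriv z).mul (hy.hasDerivAt z))).congr_deriv ?_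
    ring
  exact is_const_of_deriv_eq_zero (fun z => (hd z).differentiableAt) (fun z => (hd z).deriv) z 0

theorem IsHillSystem.wronskian {P : ℝ → ℝ} {y₁ y₂ : ℂ → ℝ → ℂ} (h : IsHillSystem P y₁ y₂)
    (nu : ℂ) (z : ℝ) : y₁ nu z * deriv (y₂ nu) z - deriv (y₁ nu) z * y₂ nu z = 1 := by
  rw [(h.sol₁ nu).wronskian_eq (h.sol₂ nu), h.init₁, h.deriv_init₁, h.init₂, h.deriv_init₂]
  ring

/-- The Wronskians of u with y₁ and y₂ are constant, hence known from the initial values; Cramer's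
rule with determinant 1 recovers u. Uniqueness for the initial value problem follows at once. -/
theorem IsHillSystem.eq_combination {P : ℝ → ℝ} {y₁ y₂ : ℂ → ℝ → ℂ} (h : IsHillSystem P y₁ y₂)
    {nu : ℂ} {u : ℝ → ℂ} (hu : IsHillSolution P nu u) (z : ℝ) :
    u z = u 0 * y₁ nu z + deriv u 0 * y₂ nu z := by
  have h1 := hu.wronskian_eq (h.sol₁ nu) z
  have h2 := hu.wronskian_eq (h.sol₂ nu) z
  rw [h.init₁, h.deriv_init₁] at h1
  rw [h.init₂, h.deriv_init₂] at h2
  linear_combination (-u z) * h.wronskian nu z + y₁ nu z * h2 - y₂ nu z * h1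

theorem IsHillSystem.unique {P : ℝ → ℝ} {y₁ y₂ : ℂ → ℝ → ℂ} (h : IsHillSystem P y₁ y₂)
    {nu : ℂ} {u w : ℝ → ℂ} (hu : IsHillSolution P nu u) (hw : IsHillSolution P nu w)
    (h0 : u 0 = w 0) (h0' : deriv u 0 = deriv w 0) : u = w := by
  funext z
  rw [h.eq_combination hu z, h.eq_combination hw z, h0, h0']

theorem exists_isHillSystem (P : ℝ → ℝ) (hP : Continuous P) {M : ℝ} (hM : ∀ z, |P z| ≤ M) :
    ∃ y₁ y₂ : ℂ → ℝ → ℂ, IsHillSystem P y₁ y₂ := by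
  have key : ∀ (a b : ℂ) (nu : ℂ), ∃ y : ℝ → ℂ,
      IsHillSolution P nu y ∧ y 0 = a ∧ deriv y 0 = b := by
    intro a b nu
    obtain ⟨y, hy⟩ := exists_hillSolution_family P hP hM (‖nu‖ + 1) (by positivity) a b
    obtain ⟨h1, h2, h3, -⟩ := hy nu (by simp)
    exact ⟨y nu, h1, h2, h3⟩
  choose y hy h0 h1 using key
  exact ⟨y 1 0, y 0 1, hy 1 0, hy 0 1, h0 1 0, h1 1 0, h0 0 1, h1 0 1⟩

/-- Hill's discriminant, the trace of the monodromy matrix. -/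
noncomputable def hillDiscriminant (y₁ y₂ : ℂ → ℝ → ℂ) (T : ℝ) (nu : ℂ) : ℂ :=
  y₁ nu T + deriv (y₂ nu) T

/-- The members of a Hill system may be chosen independently for each ν; uniqueness identifies them,
on every ball, with an analytic family. -/
theorem IsHillSystem.differentiable_hillDiscriminant {P : ℝ → ℝ} {y₁ y₂ : ℂ → ℝ → ℂ}
    (h : IsHillSystem P y₁ y₂) (hP : Continuous P) {M : ℝ} (hM : ∀ z, |P z| ≤ M) (T : ℝ) :
    Differentiable ℂ (hillDiscriminant y₁ y₂ T) := by
  intro nu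
  have hR : 0 < ‖nu‖ + 1 := by positivity
  have hnu : nu ∈ Metric.ball (0 : ℂ) (‖nu‖ + 1) := by simp
  obtain ⟨u, hu⟩ := exists_hillSolution_family P hP hM (‖nu‖ + 1) hR 1 0
  obtain ⟨w, hw⟩ := exists_hillSolution_family P hP hM (‖nu‖ + 1) hR 0 1
  refine (((hu nu hnu).2.2.2 T).1.add ((hw nu hnu).2.2.2 T).2).congr_of_eventuallyEq ?_
  filter_upwards [Metric.isOpen_ball.mem_nhds hnu] with mu hmu
  obtain ⟨a1, a2, a3, -⟩ := hu mu hmu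
  obtain ⟨b1, b2, b3, -⟩ := hw mu hmu
  have e1 : y₁ mu = u mu := h.unique (h.sol₁ mu) a1 (by rw [h.init₁, a2])
    (by rw [h.deriv_init₁, a3])
  have e2 : y₂ mu = w mu := h.unique (h.sol₂ mu) b1 (by rw [h.init₂, b2])
    (by rw [h.deriv_init₂, b3])
  simp only [hillDiscriminant, e1, e2, Pi.add_apply]

theorem IsHillSolution.conj {P : ℝ → ℝ} {nu : ℂ} {y : ℝ → ℂ} (h : IsHillSolution P nu y) :
    IsHillSolution P (starRingEnd ℂ nu) (fun z => starRingEnd ℂ (y z)) ∧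
      deriv (fun z => starRingEnd ℂ (y z)) = fun z => starRingEnd ℂ (deriv y z) := by
  refine isHillSolution_of_hasDerivAt (fun z => (h.hasDerivAt z).star) (fun z => ?_)
  refine (h.hasDerivAt_deriv z).star.congr_deriv ?_
  simp

theorem IsHillSystem.hillDiscriminant_conj {P : ℝ → ℝ} {y₁ y₂ : ℂ → ℝ → ℂ}
    (h : IsHillSystem P y₁ y₂) (T : ℝ) (nu : ℂ) :
    hillDiscriminant y₁ y₂ T (starRingEnd ℂ nu) = starRingEnd ℂ (hillDiscriminant y₁ y₂ T nu) := by
  have e1 := h.unique (h.sol₁ (starRingEnd ℂ nu)) (h.sol₁ nu).conj.1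
    (by simp [h.init₁]) (by simp [(h.sol₁ nu).conj.2, h.deriv_init₁])
  have e2 := h.unique (h.sol₂ (starRingEnd ℂ nu)) (h.sol₂ nu).conj.1
    (by simp [h.init₂]) (by simp [(h.sol₂ nu).conj.2, h.deriv_init₂])
  simp only [hillDiscriminant, e1, e2, (h.sol₂ nu).conj.2, map_add]

/-! ### Multipliers -/

theorem IsHillSystem.isHillMultiplier_iff {P : ℝ → ℝ} {y₁ y₂ : ℂ → ℝ → ℂ}
    (h : IsHillSystem P y₁ y₂) (T : ℝ) (nu μ : ℂ) :
    IsHillMultiplier P T nu μ ↔ μ ^ 2 - hillDiscriminant y₁ y₂ T nu * μ + 1 = 0 := by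
  have hW := h.wronskian nu T
  have hev : Module.End.HasEigenvalue (Matrix.toLin'
      !![y₁ nu T, y₂ nu T; deriv (y₁ nu) T, deriv (y₂ nu) T]) μ ↔
      μ ^ 2 - hillDiscriminant y₁ y₂ T nu * μ + 1 = 0 := by
    rw [Module.End.hasEigenvalue_iff_isRoot_charpoly, Matrix.charpoly_toLin',
      Matrix.charpoly_fin_two, Polynomial.IsRoot.def]
    simp only [Matrix.trace_fin_two_of, Matrix.det_fin_two_of, Polynomial.eval_add,
      Polynomial.eval_sub, Polynomial.eval_mul, Polynomial.eval_pow, Polynomial.eval_X,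
      Polynomial.eval_C, hillDiscriminant]
    rw [show y₁ nu T * deriv (y₂ nu) T - y₂ nu T * deriv (y₁ nu) T = 1 by
      linear_combination hW]
  rw [← hev]
  constructor
  · rintro ⟨u, w, hu, hw, u0, u0', w0, w0', H⟩
    rwa [h.unique hu (h.sol₁ nu) (by rw [h.init₁, u0]) (by rw [h.deriv_init₁, u0']),
      h.unique hw (h.sol₂ nu) (by rw [h.init₂, w0]) (by rw [h.deriv_init₂, w0'])] at H
  · intro H
    exact ⟨y₁ nu, y₂ nu, h.sol₁ nu, h.sol₂ nu, h.init₁ nu, h.deriv_init₁ nu, h.init₂ nu,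
      h.deriv_init₂ nu, H⟩

/-- For a real discriminant, a multiplier has unit modulus exactly if the discriminant lies
in `[-2, 2]`. -/
theorem IsHillSystem.mem_hillSpectrum_iff {P : ℝ → ℝ} {y₁ y₂ : ℂ → ℝ → ℂ}
    (h : IsHillSystem P y₁ y₂) {T : ℝ} {nu : ℂ} {d : ℝ}
    (hd : hillDiscriminant y₁ y₂ T nu = d) : nu ∈ hillSpectrum P T ↔ |d| ≤ 2 := by
  simp only [hillSpectrum, mem_ofPred_eq, h.isHillMultiplier_iff, hd]
  constructor
  · rintro ⟨μ, hμ, h1⟩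
    have hμ0 : μ ≠ 0 := by rintro rfl; simp at h1
    -- Taking norms in dμ = μ² + 1 with |μ| = 1 gives |d| ≤ 2.
    have h2 : (d : ℂ) * μ = μ * μ + 1 := by linear_combination -hμ
    have h3 : ‖(d : ℂ) * μ‖ ≤ 2 := by
      rw [h2]
      refine (norm_add_le _ _).trans ?_
      rw [norm_mul, h1]; norm_num
    rwa [norm_mul, h1, mul_one, Complex.norm_real] at h3
  · intro h2
    have h4 : 0 ≤ 1 - (d / 2) ^ 2 := by
      have := sq_abs d
      nlinarith [abs_nonneg d]
    set s := Real.sqrt (1 - (d / 2) ^ 2) with hs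
    have hs2 : s ^ 2 = 1 - (d / 2) ^ 2 := Real.sq_sqrt h4
    refine ⟨⟨d / 2, s⟩, ?_, ?_⟩
    · apply Complex.ext
      · simp [pow_two]; nlinarith
      · simp [pow_two]; ring
    · rw [Complex.norm_def, Complex.normSq_mk, Real.sqrt_eq_one]
      nlinarith

/-- A Floquet solution for a given root of the characteristic equation. -/
theorem IsHillSystem.exists_floquet_solution {P : ℝ → ℝ} {y₁ y₂ : ℂ → ℝ → ℂ}
    (h : IsHillSystem P y₁ y₂) {T : ℝ} (hP : Function.Periodic P T) {nu ρ : ℂ}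
    (hρ : ρ ^ 2 - hillDiscriminant y₁ y₂ T nu * ρ + 1 = 0) :
    ∃ y, IsHillSolution P nu y ∧ (∃ z, y z ≠ 0) ∧ ∀ z, y (z + T) = ρ * y z := by
  have hW := h.wronskian nu T
  have hdet : (!![y₁ nu T - ρ, y₂ nu T; deriv (y₁ nu) T, deriv (y₂ nu) T - ρ]).det = 0 := by
    rw [Matrix.det_fin_two_of]
    simp only [hillDiscriminant] at hρ
    linear_combination hW + hρ
  obtain ⟨v, hv0, hv⟩ := Matrix.exists_mulVec_eq_zero_iff.mpr hdet
  have hv1 := congrFun hv 0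
  have hv2 := congrFun hv 1
  simp [Matrix.mulVec, dotProduct, Fin.sum_univ_two] at hv1 hv2
  let y : ℝ → ℂ := fun z => v 0 * y₁ nu z + v 1 * y₂ nu z
  let y' : ℝ → ℂ := fun z => v 0 * deriv (y₁ nu) z + v 1 * deriv (y₂ nu) z
  obtain ⟨hy, hyd⟩ := isHillSolution_of_hasDerivAt (P := P) (nu := nu) (y := y) (v := y')
    (fun z => (((h.sol₁ nu).hasDerivAt z).const_mul _).add
      (((h.sol₂ nu).hasDerivAt z).const_mul _))
    (fun z => ((((h.sol₁ nu).hasDerivAt_deriv z).const_mul _).add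
      (((h.sol₂ nu).hasDerivAt_deriv z).const_mul _)).congr_deriv (by simp only [y]; ring))
  -- The translate y(· + T) and ρy solve the same equation; the eigenvector relation for v says that
  -- their initial data agree.
  obtain ⟨ht, htd⟩ := isHillSolution_of_hasDerivAt (P := P) (nu := nu)
    (y := fun z => y (z + T)) (v := fun z => deriv y (z + T))
    (fun z => (hy.hasDerivAt (z + T)).comp_add_const z T)
    (fun z => by
      have := (hy.hasDerivAt_deriv (z + T)).comp_add_const z T
      rwa [hP z] at this)
  obtain ⟨hr, hrd⟩ := isHillSolution_of_hasDerivAt (P := P) (nu := nu)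
    (y := fun z => ρ * y z) (v := fun z => ρ * deriv y z)
    (fun z => (hy.hasDerivAt z).const_mul ρ)
    (fun z => ((hy.hasDerivAt_deriv z).const_mul ρ).congr_deriv (by ring))
  refine ⟨y, hy, ?_, fun z => congrFun (h.unique ht hr ?_ ?_) z⟩
  · by_contra! hz
    apply hv0
    have e0 : v 0 = 0 := by simpa [y, h.init₁, h.init₂] using hz 0
    have e1 : v 1 = 0 := by
      have hy0 : y = fun _ => 0 := funext hz
      have := congrFun hyd 0
      simpa [hy0, y', h.deriv_init₁, h.deriv_init₂] using this.symm
    funext i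
    fin_cases i <;> simp [e0, e1]
  · simp only [zero_add, y, h.init₁, h.init₂]
    linear_combination hv1
  · rw [htd, hrd]
    simp only [zero_add, hyd, y', h.deriv_init₁, h.deriv_init₂]
    linear_combination hv2

/-! ### High-frequency asymptotics of the discriminant -/

/-- The discriminant as a function of the frequency `ω`, where `nu = -ω²`. -/
noncomputable def frequencyDiscriminant (y₁ y₂ : ℂ → ℝ → ℂ) (T : ℝ) (ω : ℂ) : ℂ :=
  hillDiscriminant y₁ y₂ T (-ω ^ 2)

theorem norm_exp_I_mul_le {ω : ℂ} (hω : |ω.im| ≤ 1) {T z : ℝ} (h0 : 0 ≤ z) (h1 : z ≤ T) :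
    ‖Complex.exp (Complex.I * ω * z)‖ ≤ Real.exp T ∧
      ‖Complex.exp (-(Complex.I * ω * z))‖ ≤ Real.exp T := by
  have h := abs_le.mp hω
  rw [Complex.norm_exp, Complex.norm_exp, Real.exp_le_exp, Real.exp_le_exp]
  simp
  constructor <;> nlinarith

/-- Variation of constants: the amplitudes e^{∓iωz}(u' ± iωu) are constant when P = 0 and in general
have derivative -e^{∓iωz}Pu. Since 2iωu is a difference of the two waves, the perturbation has size
O(1/|ω|), and Gronwall applies. The bound |Im ω| ≤ 1 keeps the exponentials below e^T on [0, T].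
Complex ω are admitted for the sake of the Cauchy estimates below. -/
theorem IsHillSolution.norm_wave_sub_le {P : ℝ → ℝ} {M T : ℝ} (hM0 : 0 < M)
    (hM : ∀ z, |P z| ≤ M) (hT : 0 ≤ T) {ω : ℂ} (hω : |ω.im| ≤ 1) (hω0 : ω ≠ 0) {u : ℝ → ℂ}
    (hu : IsHillSolution P (-ω ^ 2) u) {B : ℝ}
    (h1 : ‖deriv u 0 + Complex.I * ω * u 0‖ ≤ B) (h2 : ‖deriv u 0 - Complex.I * ω * u 0‖ ≤ B) :
    ‖(deriv u T + Complex.I * ω * u T)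
        - Complex.exp (Complex.I * ω * T) * (deriv u 0 + Complex.I * ω * u 0)‖
      ≤ Real.exp T * (B * (Real.exp (M * Real.exp T ^ 2 / ‖ω‖ * T) - 1)) ∧
    ‖(deriv u T - Complex.I * ω * u T)
        - Complex.exp (-(Complex.I * ω * T)) * (deriv u 0 - Complex.I * ω * u 0)‖
      ≤ Real.exp T * (B * (Real.exp (M * Real.exp T ^ 2 / ‖ω‖ * T) - 1)) := by
  have hB : 0 ≤ B := (norm_nonneg _).trans h1
  have hωn : 0 < ‖ω‖ := norm_pos_iff.mpr hω0
  set K : ℝ := M * Real.exp T ^ 2 / ‖ω‖ with hK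
  have hK0 : 0 < K := by positivity
  let e : ℝ → ℂ := fun z => Complex.exp (Complex.I * ω * z)
  let e' : ℝ → ℂ := fun z => Complex.exp (-(Complex.I * ω * z))
  have hee : ∀ z, e z * e' z = 1 := fun z => by
    simp only [e, e', ← Complex.exp_add, add_neg_cancel, Complex.exp_zero]
  have hde : ∀ z, HasDerivAt e (Complex.I * ω * e z) z := fun z => by
    have h : HasDerivAt (fun z : ℝ => Complex.I * ω * (z : ℂ)) (Complex.I * ω * 1) z :=
      (hasDerivAt_id z).ofReal_comp.const_mul _
    refine h.cexp.congr_deriv ?_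
    simp only [e]; ring
  have hde' : ∀ z, HasDerivAt e' (-(Complex.I * ω) * e' z) z := fun z => by
    have h : HasDerivAt (fun z : ℝ => -(Complex.I * ω * (z : ℂ))) (-(Complex.I * ω * 1)) z :=
      ((hasDerivAt_id z).ofReal_comp.const_mul _).neg
    refine h.cexp.congr_deriv ?_
    simp only [e']; ring
  let a : ℝ → ℂ := fun z => e' z * (deriv u z + Complex.I * ω * u z)
  let b : ℝ → ℂ := fun z => e z * (deriv u z - Complex.I * ω * u z)
  have hda : ∀ z, HasDerivAt a (e' z * (-(P z) * u z)) z := fun z => by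
    refine ((hde' z).mul ((hu.hasDerivAt_deriv z).add
      ((hu.hasDerivAt z).const_mul (Complex.I * ω)))).congr_deriv ?_
    simp only [Pi.add_apply]
    linear_combination (-(e' z * ω ^ 2 * u z)) * Complex.I_sq
  have hdb : ∀ z, HasDerivAt b (e z * (-(P z) * u z)) z := fun z => by
    refine ((hde z).mul ((hu.hasDerivAt_deriv z).sub
      ((hu.hasDerivAt z).const_mul (Complex.I * ω)))).congr_deriv ?_
    simp only [Pi.sub_apply]
    linear_combination (-(e z * ω ^ 2 * u z)) * Complex.I_sq
  have ha0 : a 0 = deriv u 0 + Complex.I * ω * u 0 := by simp [a, e']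
  have hb0 : b 0 = deriv u 0 - Complex.I * ω * u 0 := by simp [b, e]
  -- The sup norm on the product treats both amplitudes in a single Gronwall inequality. Starting
  -- from zero with forcing KB, it yields B(e^{KT} - 1).
  let X : ℝ → ℂ × ℂ := fun z => (a z - a 0, b z - b 0)
  have hX : ∀ z, HasDerivAt X (e' z * (-(P z) * u z), e z * (-(P z) * u z)) z := fun z =>
    ((hda z).sub_const _).prodMk ((hdb z).sub_const _)
  have hbound : ∀ z ∈ Ico 0 T,
      ‖(e' z * (-(P z) * u z), e z * (-(P z) * u z))‖ ≤ K * ‖X z‖ + K * B := by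
    intro z hz
    obtain ⟨he1, he2⟩ := norm_exp_I_mul_le hω hz.1 hz.2.le
    change ‖e z‖ ≤ _ at he1
    change ‖e' z‖ ≤ _ at he2
    have haX : ‖a z‖ ≤ ‖X z‖ + B := by
      calc ‖a z‖ = ‖(a z - a 0) + a 0‖ := by rw [sub_add_cancel]
        _ ≤ ‖a z - a 0‖ + ‖a 0‖ := norm_add_le _ _
        _ ≤ ‖X z‖ + B := add_le_add (norm_fst_le (X z)) (by rw [ha0]; exact h1)
    have hbX : ‖b z‖ ≤ ‖X z‖ + B := by
      calc ‖b z‖ = ‖(b z - b 0) + b 0‖ := by rw [sub_add_cancel]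
        _ ≤ ‖b z - b 0‖ + ‖b 0‖ := norm_add_le _ _
        _ ≤ ‖X z‖ + B := add_le_add (norm_snd_le (X z)) (by rw [hb0]; exact h2)
    have hX0 : 0 ≤ ‖X z‖ + B := (norm_nonneg _).trans haX
    have huz : ‖u z‖ ≤ Real.exp T * (‖X z‖ + B) / ‖ω‖ := by
      have h3 : 2 * (Complex.I * ω * u z) = e z * a z - e' z * b z := by
        simp only [a, b]
        linear_combination (-(2 * (Complex.I * ω * u z))) * hee z
      have h4 : ‖2 * (Complex.I * ω * u z)‖
          ≤ Real.exp T * (‖X z‖ + B) + Real.exp T * (‖X z‖ + B) := by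
        rw [h3]
        refine (norm_sub_le _ _).trans ?_
        rw [norm_mul (e z) (a z), norm_mul (e' z) (b z)]
        exact add_le_add (mul_le_mul he1 haX (norm_nonneg _) (Real.exp_pos _).le)
          (mul_le_mul he2 hbX (norm_nonneg _) (Real.exp_pos _).le)
      simp only [norm_mul, Complex.norm_I, one_mul, Complex.norm_ofNat] at h4
      rw [le_div_iff₀ hωn]
      linarith
    have hPu : ‖-(P z : ℂ) * u z‖ ≤ M * (Real.exp T * (‖X z‖ + B) / ‖ω‖) := by
      rw [norm_mul, norm_neg, Complex.norm_real]
      exact mul_le_mul (hM z) huz (norm_nonneg _) hM0.le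
    have hfin : ∀ E : ℂ, ‖E‖ ≤ Real.exp T → ‖E * (-(P z : ℂ) * u z)‖ ≤ K * ‖X z‖ + K * B := by
      intro E hE
      rw [norm_mul]
      calc ‖E‖ * ‖-(P z : ℂ) * u z‖
          ≤ Real.exp T * (M * (Real.exp T * (‖X z‖ + B) / ‖ω‖)) := by gcongr
        _ = K * ‖X z‖ + K * B := by rw [hK]; ring
    exact max_le (hfin _ he2) (hfin _ he1)
  have hG := norm_le_gronwallBound_of_norm_deriv_right_le (f := X) (δ := 0) (K := K)
    (ε := K * B) (a := 0) (b := T) (fun z _ => (hX z).continuousAt.continuousWithinAt)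
    (fun z _ => (hX z).hasDerivWithinAt) (by simp [X]) hbound T (right_mem_Icc.mpr hT)
  rw [gronwallBound_of_K_ne_0 hK0.ne', sub_zero] at hG
  beta_reduce at hG
  rw [zero_mul, zero_add,
    mul_div_cancel_left₀ _ hK0.ne'] at hG
  obtain ⟨he1, he2⟩ := norm_exp_I_mul_le hω hT le_rfl
  constructor
  · have h3 : (deriv u T + Complex.I * ω * u T)
        - Complex.exp (Complex.I * ω * T) * (deriv u 0 + Complex.I * ω * u 0)
        = e T * (a T - a 0) := by
      rw [ha0]
      simp only [a]
      linear_combination (-(deriv u T + Complex.I * ω * u T)) * hee T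
    rw [h3, norm_mul]
    exact mul_le_mul he1 ((norm_fst_le (X T)).trans hG) (norm_nonneg _) (Real.exp_pos _).le
  · have h3 : (deriv u T - Complex.I * ω * u T)
        - Complex.exp (-(Complex.I * ω * T)) * (deriv u 0 - Complex.I * ω * u 0)
        = e' T * (b T - b 0) := by
      rw [hb0]
      simp only [b]
      linear_combination (-(deriv u T - Complex.I * ω * u T)) * hee T
    rw [h3, norm_mul]
    exact mul_le_mul he2 ((norm_snd_le (X T)).trans hG) (norm_nonneg _) (Real.exp_pos _).le

/-- The difference of the two waves of y₁ isolates 2iωy₁, and their initial size |ω| cancels the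
factor |ω|. The sum of the two waves of y₂ isolates 2y₂', with initial size 1. -/
theorem IsHillSystem.norm_frequencyDiscriminant_sub_le {P : ℝ → ℝ} {y₁ y₂ : ℂ → ℝ → ℂ}
    (h : IsHillSystem P y₁ y₂) {M T : ℝ} (hM0 : 0 < M)
    (hM : ∀ z, |P z| ≤ M) (hT : 0 ≤ T) {ω : ℂ} (hω : |ω.im| ≤ 1) (hω0 : ω ≠ 0) :
    ‖frequencyDiscriminant y₁ y₂ T ω - 2 * Complex.cos (ω * T)‖
      ≤ 2 * (Real.exp T * (Real.exp (M * Real.exp T ^ 2 / ‖ω‖ * T) - 1)) := by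
  have hωn : 0 < ‖ω‖ := norm_pos_iff.mpr hω0
  obtain ⟨a1, a2⟩ := (h.sol₁ (-ω ^ 2)).norm_wave_sub_le hM0 hM hT hω hω0 (B := ‖ω‖)
    (by simp [h.init₁, h.deriv_init₁]) (by simp [h.init₁, h.deriv_init₁])
  obtain ⟨b1, b2⟩ := (h.sol₂ (-ω ^ 2)).norm_wave_sub_le hM0 hM hT hω hω0 (B := 1)
    (by simp [h.init₂, h.deriv_init₂]) (by simp [h.init₂, h.deriv_init₂])
  set L := Real.exp (M * Real.exp T ^ 2 / ‖ω‖ * T) - 1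
  rw [h.init₁, h.deriv_init₁] at a1 a2
  rw [h.init₂, h.deriv_init₂] at b1 b2
  have hcos : 2 * Complex.cos (ω * T)
      = Complex.exp (Complex.I * ω * T) + Complex.exp (-(Complex.I * ω * T)) := by
    rw [Complex.two_cos]
    congr 2 <;> ring
  have e1 : 2 * (Complex.I * ω) * (y₁ (-ω ^ 2) T - Complex.cos (ω * T))
      = (deriv (y₁ (-ω ^ 2)) T + Complex.I * ω * y₁ (-ω ^ 2) T
          - Complex.exp (Complex.I * ω * T) * (0 + Complex.I * ω * 1))
        - (deriv (y₁ (-ω ^ 2)) T - Complex.I * ω * y₁ (-ω ^ 2) T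
          - Complex.exp (-(Complex.I * ω * T)) * (0 - Complex.I * ω * 1)) := by
    linear_combination (-(Complex.I * ω)) * hcos
  have e2 : 2 * (deriv (y₂ (-ω ^ 2)) T - Complex.cos (ω * T))
      = (deriv (y₂ (-ω ^ 2)) T + Complex.I * ω * y₂ (-ω ^ 2) T
          - Complex.exp (Complex.I * ω * T) * (1 + Complex.I * ω * 0))
        + (deriv (y₂ (-ω ^ 2)) T - Complex.I * ω * y₂ (-ω ^ 2) T
          - Complex.exp (-(Complex.I * ω * T)) * (1 - Complex.I * ω * 0)) := by
    linear_combination -hcos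
  have n1 : ‖y₁ (-ω ^ 2) T - Complex.cos (ω * T)‖ ≤ Real.exp T * L := by
    have h3 := (norm_sub_le _ _).trans (add_le_add a1 a2)
    rw [← e1] at h3
    simp only [norm_mul, Complex.norm_I, one_mul, Complex.norm_ofNat] at h3
    have h4 : ‖ω‖ * ‖y₁ (-ω ^ 2) T - Complex.cos (ω * T)‖ ≤ ‖ω‖ * (Real.exp T * L) := by
      linarith
    exact le_of_mul_le_mul_left h4 hωn
  have n2 : ‖deriv (y₂ (-ω ^ 2)) T - Complex.cos (ω * T)‖ ≤ Real.exp T * L := by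
    have h3 := (norm_add_le _ _).trans (add_le_add b1 b2)
    rw [← e2] at h3
    simp only [norm_mul, one_mul, Complex.norm_ofNat] at h3
    linarith
  calc ‖frequencyDiscriminant y₁ y₂ T ω - 2 * Complex.cos (ω * T)‖
      = ‖(y₁ (-ω ^ 2) T - Complex.cos (ω * T))
        + (deriv (y₂ (-ω ^ 2)) T - Complex.cos (ω * T))‖ := by
        congr 1
        simp only [frequencyDiscriminant, hillDiscriminant]; ring
    _ ≤ 2 * (Real.exp T * L) := by
        refine (norm_add_le _ _).trans ?_
        linarith

/-- Cauchy's estimate on circles of radius r, at the price of narrowing the strip by r. -/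
theorem norm_deriv_le_of_norm_le_strip {F : ℂ → ℂ} (hF : Differentiable ℂ F) {R ε r s : ℝ}
    (hr : 0 < r) (h : ∀ ω : ℂ, |ω.im| ≤ s + r → R ≤ ω.re → ‖F ω‖ ≤ ε) :
    ∀ ω : ℂ, |ω.im| ≤ s → R + r ≤ ω.re → ‖deriv F ω‖ ≤ ε / r := by
  intro ω h1 h2
  refine Complex.norm_deriv_le_of_forall_mem_sphere_norm_le hr hF.diffContOnCl fun z hz => ?_
  have hz' : ‖z - ω‖ = r := by simpa [dist_eq_norm] using hz
  have him : |(z - ω).im| ≤ r := hz' ▸ Complex.abs_im_le_norm _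
  have hre : |(z - ω).re| ≤ r := hz' ▸ Complex.abs_re_le_norm _
  rw [Complex.sub_im] at him
  rw [Complex.sub_re] at hre
  rw [abs_le] at him hre h1
  exact h z (abs_le.mpr ⟨by linarith, by linarith⟩) (by linarith)

theorem IsHillSystem.differentiable_frequencyDiscriminant {P : ℝ → ℝ} {y₁ y₂ : ℂ → ℝ → ℂ}
    (h : IsHillSystem P y₁ y₂) (hP : Continuous P) {M : ℝ} (hM : ∀ z, |P z| ≤ M) (T : ℝ) :
    Differentiable ℂ (frequencyDiscriminant y₁ y₂ T) :=
  (h.differentiable_hillDiscriminant hP hM T).comp (by fun_prop : Differentiable ℂ fun ω : ℂ => -ω ^ 2)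

theorem IsHillSystem.frequencyDiscriminant_asymptotics {P : ℝ → ℝ} {y₁ y₂ : ℂ → ℝ → ℂ}
    (h : IsHillSystem P y₁ y₂) (hP : Continuous P) {M T : ℝ} (hM0 : 0 < M)
    (hM : ∀ z, |P z| ≤ M) (hT : 0 < T) {ε : ℝ} (hε : 0 < ε) :
    ∃ R : ℝ, 0 < R ∧ ∀ x : ℝ, R ≤ x →
      ‖frequencyDiscriminant y₁ y₂ T x - 2 * Complex.cos (x * T)‖ ≤ ε ∧
      ‖deriv (frequencyDiscriminant y₁ y₂ T) x + 2 * T * Complex.sin (x * T)‖ ≤ ε ∧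
      ‖deriv (deriv (frequencyDiscriminant y₁ y₂ T)) x + 2 * T ^ 2 * Complex.cos (x * T)‖
        ≤ ε := by
  set D := frequencyDiscriminant y₁ y₂ T with hD
  have hDd : Differentiable ℂ D := h.differentiable_frequencyDiscriminant hP hM T
  have hDd' : Differentiable ℂ (deriv D) := fun z =>
    ((hDd.analyticAt z).deriv).differentiableAt
  let F : ℂ → ℂ := fun ω => D ω - 2 * Complex.cos (ω * T)
  have hF : Differentiable ℂ F := hDd.sub (by fun_prop)
  have hcos : ∀ ω : ℂ, HasDerivAt (fun ω : ℂ => 2 * Complex.cos (ω * T))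
      (-(2 * T * Complex.sin (ω * T))) ω := fun ω => by
    refine ((((hasDerivAt_id ω).mul_const (T : ℂ)).ccos).const_mul 2).congr_deriv ?_
    simp only [id]; ring
  have hsin : ∀ ω : ℂ, HasDerivAt (fun ω : ℂ => 2 * T * Complex.sin (ω * T))
      (2 * T ^ 2 * Complex.cos (ω * T)) ω := fun ω => by
    refine ((((hasDerivAt_id ω).mul_const (T : ℂ)).csin).const_mul (2 * (T : ℂ))).congr_deriv ?_
    simp only [id]; ring
  have hF' : deriv F = fun ω => deriv D ω + 2 * T * Complex.sin (ω * T) := by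
    funext ω
    rw [← sub_neg_eq_add]
    exact ((hDd ω).hasDerivAt.sub (hcos ω)).deriv
  have hF'' : deriv (deriv F) = fun ω => deriv (deriv D) ω + 2 * T ^ 2 * Complex.cos (ω * T) := by
    funext ω
    rw [hF']
    exact ((hDd' ω).hasDerivAt.add (hsin ω)).deriv
  have hFd' : Differentiable ℂ (deriv F) := fun z => ((hF.analyticAt z).deriv).differentiableAt
  -- Chosen so that 2e^T(e^δ - 1) = ε/4. Two Cauchy estimates of radius 1/2 shrink the strip from
  -- half-width 1 to 1/2 to 0 and enlarge the bound from ε/4 to ε/2 to ε.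
  set δ : ℝ := Real.log (1 + ε / 8 / Real.exp T) with hδ
  have hpos : 0 < ε / 8 / Real.exp T := by positivity
  have hδ0 : 0 < δ := Real.log_pos (by linarith)
  set R₀ : ℝ := M * Real.exp T ^ 2 * T / δ with hR₀
  have hR₀0 : 0 < R₀ := by positivity
  have hF0 : ∀ ω : ℂ, |ω.im| ≤ 1 / 2 + 1 / 2 → R₀ ≤ ω.re → ‖F ω‖ ≤ ε / 4 := by
    intro ω h1 h2
    have h3 : R₀ ≤ ‖ω‖ := h2.trans ((le_abs_self _).trans (Complex.abs_re_le_norm ω))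
    have h4 : 0 < ‖ω‖ := hR₀0.trans_le h3
    refine (h.norm_frequencyDiscriminant_sub_le hM0 hM hT.le (by linarith)
      (norm_pos_iff.mp h4)).trans ?_
    have h5 : M * Real.exp T ^ 2 / ‖ω‖ * T ≤ δ := by
      rw [hR₀, div_le_iff₀ hδ0] at h3
      rw [div_mul_eq_mul_div, div_le_iff₀ h4]
      linarith
    have h6 : Real.exp (M * Real.exp T ^ 2 / ‖ω‖ * T) - 1 ≤ ε / 8 / Real.exp T := by
      have := Real.exp_le_exp.mpr h5
      rw [hδ, Real.exp_log (by linarith)] at this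
      linarith
    calc 2 * (Real.exp T * (Real.exp (M * Real.exp T ^ 2 / ‖ω‖ * T) - 1))
        ≤ 2 * (Real.exp T * (ε / 8 / Real.exp T)) := by gcongr
      _ = ε / 4 := by field_simp; norm_num
  have hF1 := norm_deriv_le_of_norm_le_strip hF (r := 1 / 2) (s := 1 / 2) (by norm_num) hF0
  have hF2 := norm_deriv_le_of_norm_le_strip hFd' (r := 1 / 2) (s := 0) (by norm_num)
    (fun ω h1 h2 => hF1 ω (by simpa using h1) h2)
  refine ⟨R₀ + 1, by linarith, fun x hx => ⟨?_, ?_, ?_⟩⟩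
  · have := hF0 x (by simp) (by simp; linarith)
    change ‖F x‖ ≤ ε
    linarith
  · have := hF1 x (by simp) (by simp; linarith)
    rw [hF'] at this
    linarith
  · have := hF2 x (by simp) (by simp; linarith)
    rw [hF''] at this
    linarith

/-! ### Nonreal points on the real level set at a critical point -/

/-- If `h` is analytic at the real point `x₀`, real on the real axis, and `h'(x₀) = 0`, then `h`
takes real values at nonreal points arbitrarily close to `x₀`. -/
theorem exists_nonreal_of_deriv_eq_zero {h : ℂ → ℂ} {x₀ : ℝ} (ha : AnalyticAt ℂ h x₀)
    (hreal : ∀ᶠ x : ℝ in 𝓝 x₀, (h x).im = 0) (hd : deriv h x₀ = 0) {U : Set ℂ}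
    (hU : U ∈ 𝓝 (x₀ : ℂ)) : ∃ ω ∈ U, ω.im ≠ 0 ∧ (h ω).im = 0 := by
  have h0 : (h x₀).im = 0 := hreal.self_of_nhds
  let f : ℂ → ℂ := fun z => h z - h x₀
  have hf : AnalyticAt ℂ f x₀ := ha.sub analyticAt_const
  have hfim : ∀ z, (f z).im = (h z).im := fun z => by simp [f, h0]
  by_cases hz : ∀ᶠ z in 𝓝 (x₀ : ℂ), f z = 0
  · obtain ⟨r, hr, hball⟩ := Metric.mem_nhds_iff.mp (Filter.inter_mem hU hz)
    have hmem : (x₀ : ℂ) + Complex.I * (r / 2 : ℝ) ∈ Metric.ball (x₀ : ℂ) r := by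
      rw [Metric.mem_ball, dist_eq_norm, add_sub_cancel_left, norm_mul, Complex.norm_I, one_mul,
        Complex.norm_real, Real.norm_of_nonneg (by positivity)]
      linarith
    obtain ⟨h1, h2⟩ := hball hmem
    refine ⟨_, h1, ?_, ?_⟩
    · simpa using hr.ne'
    · rw [← hfim, show f _ = 0 from h2, Complex.zero_im]
  obtain ⟨m, g, hg, hg0, hfg⟩ := hf.exists_eventuallyEq_pow_smul_nonzero_iff.mpr hz
  simp only [smul_eq_mul] at hfg
  have hm0 : m ≠ 0 := by
    rintro rfl
    have := hfg.self_of_nhds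
    simp only [f, sub_self, pow_zero, one_mul] at this
    exact hg0 this.symm
  have hm1 : m ≠ 1 := by
    rintro rfl
    have h1 : HasDerivAt f (g x₀) x₀ := by
      have h2 := (((hasDerivAt_id (x₀ : ℂ)).sub_const (x₀ : ℂ)).mul
        hg.differentiableAt.hasDerivAt)
      have h3 : HasDerivAt (fun z : ℂ => (z - x₀) ^ 1 * g z) (g x₀) x₀ := by
        refine (h2.congr_deriv ?_).congr_of_eventuallyEq (Filter.Eventually.of_forall fun z => ?_)
        · simp
        · simp
      exact h3.congr_of_eventuallyEq hfg
    have h2 : HasDerivAt f (deriv h x₀) x₀ := ha.differentiableAt.hasDerivAt.sub_const _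
    exact hg0 ((h1.unique h2).trans hd)
  have hm : 2 ≤ m := by omega
  -- On the real axis f and (x - x₀)^m are real, so g is real there off x₀, and at x₀ by continuity.
  have hgim : (g x₀).im = 0 := by
    have hcast : Filter.Tendsto (fun x : ℝ => (x : ℂ)) (𝓝 x₀) (𝓝 (x₀ : ℂ)) :=
      Complex.continuous_ofReal.tendsto x₀
    have hc : Filter.Tendsto (fun x : ℝ => (g x).im) (𝓝[≠] x₀) (𝓝 (g x₀).im) :=
      ((Complex.continuous_im.tendsto _).comp
        (hg.continuousAt.tendsto.comp hcast)).mono_left nhdsWithin_le_nhds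
    refine tendsto_nhds_unique (hc.congr' ?_) (tendsto_const_nhds (x := (0 : ℝ)))
    filter_upwards [self_mem_nhdsWithin, nhdsWithin_le_nhds hreal,
      nhdsWithin_le_nhds (hcast.eventually hfg)] with x hx1 hx2 hx3
    rw [← hfim, hx3, ← Complex.ofReal_sub, ← Complex.ofReal_pow, Complex.im_ofReal_mul] at hx2
    exact (mul_eq_zero.mp hx2).resolve_left (pow_ne_zero _ (sub_ne_zero.mpr hx1))
  have hgre : (g x₀).re ≠ 0 := fun hre => hg0 (Complex.ext hre hgim)
  have hsign : ∀ᶠ z in 𝓝 (x₀ : ℂ), 0 < (g z).re * (g x₀).re := by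
    have hc : ContinuousAt (fun z => (g z).re * (g x₀).re) (x₀ : ℂ) :=
      (Complex.continuous_re.continuousAt.comp hg.continuousAt).mul continuousAt_const
    exact hc.eventually (lt_mem_nhds (mul_self_pos.mpr hgre))
  obtain ⟨r, hr, hball⟩ := Metric.mem_nhds_iff.mp
    (Filter.inter_mem hU (Filter.inter_mem hfg (Filter.inter_mem hsign hf.eventually_analyticAt)))
  -- On this circle f is a positive multiple of e^{imφ}g. At φ = π/(2m) and 3π/(2m) the exponential
  -- is i and -i, while Re g keeps its sign, so Im f changes sign in between. As m ≥ 2, both angles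
  -- lie in (0, π), so the zero of Im f is nonreal.
  let p : ℝ → ℂ := fun φ => x₀ + (r / 2 : ℝ) * Complex.exp (φ * Complex.I)
  have hp : ∀ φ, p φ ∈ Metric.ball (x₀ : ℂ) r := fun φ => by
    rw [Metric.mem_ball, dist_eq_norm, add_sub_cancel_left, norm_mul,
      Complex.norm_exp_ofReal_mul_I, mul_one, Complex.norm_real,
      Real.norm_of_nonneg (by positivity)]
    linarith
  have hpc : Continuous p := by fun_prop
  have hψ : Continuous fun φ => (f (p φ)).im := by
    rw [continuous_iff_continuousAt]
    intro φ
    have h1 : ContinuousAt f (p φ) := (hball (hp φ)).2.2.2.continuousAt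
    exact Complex.continuous_im.continuousAt.comp (h1.comp hpc.continuousAt)
  have hval : ∀ φ, f (p φ) = ((r / 2) ^ m : ℝ) * (Complex.exp ((m * φ : ℝ) * Complex.I) * g (p φ)) := by
    intro φ
    have h1 : f (p φ) = (p φ - x₀) ^ m * g (p φ) := (hball (hp φ)).2.1
    rw [h1, add_sub_cancel_left, mul_pow, ← Complex.exp_nat_mul]
    push_cast
    ring_nf
  have hmR : (2 : ℝ) ≤ m := by exact_mod_cast hm
  have hmpos : (0 : ℝ) < m := by linarith
  have hv1 : (f (p (Real.pi / (2 * m)))).im = (r / 2) ^ m * (g (p (Real.pi / (2 * m)))).re := by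
    rw [hval, Complex.im_ofReal_mul, show (m * (Real.pi / (2 * m)) : ℝ) = Real.pi / 2 by
      field_simp]
    push_cast
    rw [Complex.exp_pi_div_two_mul_I]
    simp
  have hv2 : (f (p (3 * Real.pi / (2 * m)))).im
      = -((r / 2) ^ m * (g (p (3 * Real.pi / (2 * m)))).re) := by
    rw [hval, Complex.im_ofReal_mul, show (m * (3 * Real.pi / (2 * m)) : ℝ)
      = Real.pi + Real.pi / 2 by field_simp; ring]
    push_cast
    rw [add_mul, Complex.exp_add, Complex.exp_pi_mul_I, Complex.exp_pi_div_two_mul_I]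
    simp
  have hs1 := (hball (hp (Real.pi / (2 * m)))).2.2.1
  have hs2 := (hball (hp (3 * Real.pi / (2 * m)))).2.2.1
  simp only [mem_ofPred_eq] at hs1 hs2
  have hrm : 0 < (r / 2) ^ m := by positivity
  have hzero : (0 : ℝ) ∈ uIcc (f (p (Real.pi / (2 * m)))).im (f (p (3 * Real.pi / (2 * m)))).im := by
    rw [hv1, hv2, mem_uIcc]
    rcases lt_or_gt_of_ne hgre with hneg | hpos
    · left
      have a1 : (g (p (Real.pi / (2 * m)))).re < 0 := by nlinarith
      have a2 : (g (p (3 * Real.pi / (2 * m)))).re < 0 := by nlinarith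
      constructor <;> nlinarith
    · right
      have a1 : 0 < (g (p (Real.pi / (2 * m)))).re := by nlinarith
      have a2 : 0 < (g (p (3 * Real.pi / (2 * m)))).re := by nlinarith
      constructor <;> nlinarith
  obtain ⟨φ, hφ, hφ0⟩ := intermediate_value_uIcc hψ.continuousOn hzero
  have hle : Real.pi / (2 * m) ≤ 3 * Real.pi / (2 * m) := by
    gcongr
    linarith [Real.pi_pos]
  rw [uIcc_of_le hle] at hφ
  have hφ1 : 0 < φ := lt_of_lt_of_le (by positivity) hφ.1
  have hφ2 : φ < Real.pi := by
    refine lt_of_le_of_lt hφ.2 ?_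
    rw [div_lt_iff₀ (by positivity)]
    nlinarith [Real.pi_pos]
  refine ⟨p φ, (hball (hp φ)).1, ?_, ?_⟩
  · have h1 : (p φ).im = r / 2 * Real.sin φ := by
      simp only [p, Complex.add_im, Complex.ofReal_im, zero_add, Complex.im_ofReal_mul,
        Complex.exp_ofReal_mul_I_im]
    rw [h1]
    have := Real.sin_pos_of_pos_of_lt_pi hφ1 hφ2
    positivity
  · rw [← hfim]; exact hφ0

/-- The equation `2 cos (θ - k ω) = D(ω)` has solutions with `θ` real and `ω` nonreal near a real
point where the frequency derivative of the phase vanishes. -/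
theorem exists_nonreal_phase {D : ℂ → ℂ} (hD : Differentiable ℂ D)
    (hconj : ∀ ω, D (starRingEnd ℂ ω) = starRingEnd ℂ (D ω)) {k x₀ θ₀ : ℝ}
    (h0 : D x₀ = 2 * Complex.cos θ₀) (h1 : deriv D x₀ = 2 * k * Complex.sin θ₀)
    (hs : Real.sin θ₀ ≠ 0) {U : Set ℂ} (hU : U ∈ 𝓝 (x₀ : ℂ)) :
    ∃ ω ∈ U, ω.im ≠ 0 ∧ ∃ θ : ℝ, 2 * Complex.cos (θ - k * ω) = D ω := by
  have hs' : Complex.sin (θ₀ : ℂ) ≠ 0 := by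
    rw [← Complex.ofReal_sin]
    exact_mod_cast hs
  have hca : AnalyticAt ℂ Complex.cos (θ₀ : ℂ) := Complex.differentiable_cos.analyticAt _
  have hcd : deriv Complex.cos (θ₀ : ℂ) ≠ 0 := by
    rw [Complex.deriv_cos]
    exact neg_ne_zero.mpr hs'
  have hcs := hca.hasStrictDerivAt
  let L := hcs.localInverse _ _ _ hcd
  have hLa : AnalyticAt ℂ L (Complex.cos θ₀) := hca.analyticAt_localInverse hcd
  have hLd : HasStrictDerivAt L (-Complex.sin (θ₀ : ℂ))⁻¹ (Complex.cos θ₀) := by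
    rw [← Complex.deriv_cos]
    exact hcs.to_localInverse hcd
  have hr : ∀ᶠ w in 𝓝 (Complex.cos (θ₀ : ℂ)), Complex.cos (L w) = w :=
    hcs.eventually_right_inverse hcd
  have hl : ∀ᶠ w in 𝓝 (θ₀ : ℂ), L (Complex.cos w) = w :=
    hcs.eventually_left_inverse hcd
  have hL0 : L (Complex.cos θ₀) = θ₀ := hl.self_of_nhds
  -- A is the branch of arccos(D/2) with A(x₀) = θ₀, available because sin θ₀ ≠ 0; `h1` makes A' =
  -- -k there, so x₀ is critical for A + kω.
  let A : ℂ → ℂ := fun ω => L (D ω / 2)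
  have hD2 : D x₀ / 2 = Complex.cos θ₀ := by rw [h0]; ring
  have hAa : AnalyticAt ℂ A x₀ := by
    refine AnalyticAt.fun_comp (f := fun ω => D ω / 2) (g := L) ?_
      ((hD.analyticAt _).div analyticAt_const two_ne_zero)
    rw [hD2]; exact hLa
  have hA0 : A x₀ = θ₀ := by simp only [A, hD2, hL0]
  have hAd : HasDerivAt A (-k) x₀ := by
    have e1 : HasDerivAt (fun ω => D ω / 2) (deriv D x₀ / 2) x₀ :=
      (hD x₀).hasDerivAt.div_const 2
    have e2 : HasDerivAt L (-Complex.sin (θ₀ : ℂ))⁻¹ (D x₀ / 2) := by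
      rw [hD2]; exact hLd.hasDerivAt
    refine (e2.comp (x₀ : ℂ) e1).congr_deriv ?_
    rw [h1]
    field_simp
  have hDt : Filter.Tendsto (fun ω => D ω / 2) (𝓝 (x₀ : ℂ)) (𝓝 (Complex.cos θ₀)) := by
    rw [← hD2]
    exact ((hD x₀).continuousAt.div_const 2).tendsto
  have hAc : ∀ᶠ ω in 𝓝 (x₀ : ℂ), Complex.cos (A ω) = D ω / 2 := hDt.eventually hr
  have hAt : Filter.Tendsto A (𝓝 (x₀ : ℂ)) (𝓝 (θ₀ : ℂ)) := by
    rw [← hA0]; exact hAa.continuousAt.tendsto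
  have hAt' : Filter.Tendsto (fun ω => starRingEnd ℂ (A ω)) (𝓝 (x₀ : ℂ)) (𝓝 (θ₀ : ℂ)) := by
    have := (Complex.continuous_conj.tendsto (θ₀ : ℂ)).comp hAt
    rwa [Complex.conj_ofReal] at this
  have hcast : Filter.Tendsto (fun x : ℝ => (x : ℂ)) (𝓝 x₀) (𝓝 (x₀ : ℂ)) :=
    Complex.continuous_ofReal.tendsto x₀
  let h : ℂ → ℂ := fun ω => A ω + k * ω
  -- For real x, both A(x) and its conjugate are near θ₀ and have the same cosine; local injectivity
  -- of the cosine makes them equal.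
  have hreal : ∀ᶠ x : ℝ in 𝓝 x₀, (h x).im = 0 := by
    filter_upwards [hcast.eventually hAc, hcast.eventually (hAt.eventually hl),
      hcast.eventually (hAt'.eventually hl)] with x e1 e2 e3
    have e4 : Complex.cos (starRingEnd ℂ (A x)) = Complex.cos (A x) := by
      rw [Complex.cos_conj, e1, map_div₀, ← hconj, Complex.conj_ofReal, map_ofNat]
    rw [e4, e2] at e3
    have e5 : (A x).im = 0 := Complex.conj_eq_iff_im.mp e3.symm
    simp [h, e5]
  have hhd : deriv h x₀ = 0 := by
    have e1 : HasDerivAt h (-(k : ℂ) + k * 1) x₀ :=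
      hAd.add ((hasDerivAt_id (x₀ : ℂ)).const_mul (k : ℂ))
    rw [e1.deriv]; ring
  have hha : AnalyticAt ℂ h x₀ := hAa.add (analyticAt_const.mul analyticAt_id)
  obtain ⟨ω, ⟨hωU, hωc⟩, him, hω⟩ := exists_nonreal_of_deriv_eq_zero hha hreal hhd
    (Filter.inter_mem hU hAc)
  refine ⟨ω, hωU, him, (h ω).re, ?_⟩
  have e1 : (((h ω).re : ℝ) : ℂ) = h ω := Complex.ext (by simp) (by simp [hω])
  have hωc' : Complex.cos (A ω) = D ω / 2 := hωc
  rw [e1, show h ω - k * ω = A ω by simp only [h]; ring, hωc']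
  ring

/-! ### Real functions asymptotic to a cosine -/

/-- A strictly concave function meets the level 2 at most twice. Rolle gives a critical point
between a and b, and strict decrease of the derivative makes the slopes at a and b nonzero. -/
theorem lt_two_of_concave {e e1 e2 : ℝ → ℝ} {p q a b : ℝ} (he : ∀ x, HasDerivAt e (e1 x) x)
    (he1 : ∀ x, HasDerivAt e1 (e2 x) x) (hneg : ∀ x ∈ Icc p q, e2 x < 0)
    (ha : a ∈ Icc p q) (hb : b ∈ Icc p q) (hab : a < b) (ha2 : e a = 2) (hb2 : e b = 2) :
    (∀ x ∈ Icc p q, x < a ∨ b < x → e x < 2) ∧ (∀ x ∈ Ioo a b, 2 < e x) ∧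
      e1 a ≠ 0 ∧ e1 b ≠ 0 := by
  have hanti : StrictAntiOn e1 (Icc p q) := by
    refine strictAntiOn_of_deriv_neg (convex_Icc p q)
      (fun x _ => (he1 x).continuousAt.continuousWithinAt) fun x hx => ?_
    rw [(he1 x).deriv]
    exact hneg x (interior_subset hx)
  have hconc : StrictConcaveOn ℝ (Icc p q) e := by
    refine StrictAntiOn.strictConcaveOn_of_deriv (convex_Icc p q)
      (fun x _ => (he x).continuousAt.continuousWithinAt) ?_
    rw [show deriv e = e1 from funext fun x => (he x).deriv]
    exact hanti.mono interior_subset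
  obtain ⟨ξ, hξ, hξ0⟩ := exists_hasDerivAt_eq_zero hab
    (fun x _ => (he x).continuousAt.continuousWithinAt) (ha2.trans hb2.symm) (fun x _ => he x)
  have hξI : ξ ∈ Icc p q := ⟨ha.1.trans hξ.1.le, hξ.2.le.trans hb.2⟩
  have key : ∀ x ∈ Icc p q, ∀ y ∈ Icc p q, ∀ z, x < z → z < y → min (e x) (e y) < e z := by
    intro x hx y hy z hxz hzy
    refine hconc.lt_on_openSegment hx hy (hxz.trans hzy).ne ?_
    rw [openSegment_eq_Ioo (hxz.trans hzy)]
    exact ⟨hxz, hzy⟩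
  refine ⟨fun x hx hx' => ?_, fun x hx => ?_, ?_, ?_⟩
  · by_contra! hcon
    rcases hx' with h | h
    · have := key x hx b hb a h hab
      rw [ha2, hb2, min_eq_right hcon] at this
      exact lt_irrefl _ this
    · have := key a ha x hx b hab h
      rw [ha2, hb2, min_eq_left hcon] at this
      exact lt_irrefl _ this
  · have := key a ha b hb x hx.1 hx.2
    rwa [ha2, hb2, min_self] at this
  · have := hanti ha hξI hξ.1
    rw [hξ0] at this
    exact this.ne'
  · have := hanti hξI hb hξ.2
    rw [hξ0] at this
    exact this.ne

theorem eq_of_concave {e e1 e2 : ℝ → ℝ} {p q a b a' b' : ℝ} (he : ∀ x, HasDerivAt e (e1 x) x)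
    (he1 : ∀ x, HasDerivAt e1 (e2 x) x) (hneg : ∀ x ∈ Icc p q, e2 x < 0)
    (ha : a ∈ Icc p q) (hb : b ∈ Icc p q) (hab : a < b) (ha2 : e a = 2) (hb2 : e b = 2)
    (ha' : a' ∈ Icc p q) (hb' : b' ∈ Icc p q) (hab' : a' < b') (ha2' : e a' = 2)
    (hb2' : e b' = 2) : a = a' ∧ b = b' := by
  obtain ⟨h1, h2, -⟩ := lt_two_of_concave he he1 hneg ha hb hab ha2 hb2
  have key : ∀ x ∈ Icc p q, e x = 2 → x = a ∨ x = b := by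
    intro x hx hx2
    rcases lt_trichotomy x a with h | h | h
    · exact absurd hx2 (h1 x hx (Or.inl h)).ne
    · exact Or.inl h
    · rcases lt_trichotomy x b with h' | h' | h'
      · exact absurd hx2 (h2 x ⟨h, h'⟩).ne'
      · exact Or.inr h'
      · exact absurd hx2 (h1 x hx (Or.inr h')).ne
  rcases key a' ha' ha2' with r | r <;> rcases key b' hb' hb2' with r' | r'
  · exact absurd (r.trans r'.symm) hab'.ne
  · exact ⟨r.symm, r'.symm⟩
  · rw [r, r'] at hab'
    exact absurd hab hab'.not_gt
  · exact absurd (r.trans r'.symm) hab'.ne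

/-- `d`, with derivatives `d1` and `d2`, is close to `2 cos (T x)` in the `C²` sense for `x ≥ R`. -/
structure IsNearCosine (d d1 d2 : ℝ → ℝ) (T ε R : ℝ) : Prop where
  hasDerivAt : ∀ x, HasDerivAt d (d1 x) x
  hasDerivAt_deriv : ∀ x, HasDerivAt d1 (d2 x) x
  T_pos : 0 < T
  ε_le : ε ≤ 1 / 3
  near : ∀ x, R ≤ x → |d x - 2 * Real.cos (x * T)| ≤ ε
  near_deriv : ∀ x, R ≤ x → |d1 x + 2 * T * Real.sin (x * T)| ≤ T * ε
  near_deriv2 : ∀ x, R ≤ x → |d2 x + 2 * T ^ 2 * Real.cos (x * T)| ≤ T ^ 2 * ε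

/-- Left end of the interval around `n π / T`. -/
noncomputable def archLeft (T : ℝ) (n : ℤ) : ℝ := (n * Real.pi - Real.pi / 3) / T

/-- Right end of the interval around `n π / T`. -/
noncomputable def archRight (T : ℝ) (n : ℤ) : ℝ := (n * Real.pi + Real.pi / 3) / T

/-- Throughout, cos(nπ) plays the role of the sign (-1)ⁿ for n ∈ ℤ. -/
theorem cos_int_mul_pi_sq (n : ℤ) : Real.cos (n * Real.pi) ^ 2 = 1 := by
  have := Real.sin_sq_add_cos_sq (n * Real.pi)
  rw [Real.sin_int_mul_pi] at this
  linarith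

theorem abs_cos_int_mul_pi (n : ℤ) : |Real.cos (n * Real.pi)| = 1 := by
  rw [← sq_eq_sq₀ (abs_nonneg _) zero_le_one, sq_abs, cos_int_mul_pi_sq, one_pow]

theorem cos_sub_int_mul_pi_eq (x : ℝ) (n : ℤ) :
    Real.cos (x - n * Real.pi) = Real.cos (n * Real.pi) * Real.cos x := by
  rw [Real.cos_sub, Real.sin_int_mul_pi]; ring

theorem half_le_cos_of_mem_arch {T : ℝ} (hT : 0 < T) {n : ℤ} {x : ℝ}
    (hx : x ∈ Icc (archLeft T n) (archRight T n)) :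
    1 / 2 ≤ Real.cos (n * Real.pi) * Real.cos (x * T) := by
  obtain ⟨h1, h2⟩ := hx
  rw [archLeft, div_le_iff₀ hT] at h1
  rw [archRight, le_div_iff₀ hT] at h2
  rw [← cos_sub_int_mul_pi_eq, ← Real.cos_abs, ← Real.cos_pi_div_three]
  refine Real.cos_le_cos_of_nonneg_of_le_pi (abs_nonneg _) (by linarith [Real.pi_pos]) ?_
  rw [abs_le]
  constructor <;> linarith

section

variable {d d1 d2 : ℝ → ℝ} {T ε R : ℝ}

theorem IsNearCosine.abs_sign_mul_sub (h : IsNearCosine d d1 d2 T ε R) (n : ℤ) {x : ℝ}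
    (hx : R ≤ x) :
    |Real.cos (n * Real.pi) * d x - 2 * (Real.cos (n * Real.pi) * Real.cos (x * T))| ≤ ε := by
  have := h.near x hx
  calc _ = |Real.cos (n * Real.pi) * (d x - 2 * Real.cos (x * T))| := by congr 1; ring
    _ ≤ ε := by rwa [abs_mul, abs_cos_int_mul_pi, one_mul]

theorem IsNearCosine.le_sign_mul (h : IsNearCosine d d1 d2 T ε R) {n : ℤ}
    (hR : R ≤ archLeft T n) {x : ℝ} (hx : x ∈ Icc (archLeft T n) (archRight T n)) :
    2 / 3 ≤ Real.cos (n * Real.pi) * d x := by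
  have h1 := (abs_le.mp (h.abs_sign_mul_sub n (hR.trans hx.1))).1
  have h2 := half_le_cos_of_mem_arch h.T_pos hx
  linarith [h.ε_le]

theorem IsNearCosine.abs_eq (h : IsNearCosine d d1 d2 T ε R) {n : ℤ}
    (hR : R ≤ archLeft T n) {x : ℝ} (hx : x ∈ Icc (archLeft T n) (archRight T n)) :
    |d x| = Real.cos (n * Real.pi) * d x := by
  have := h.le_sign_mul hR hx
  rw [← abs_of_nonneg (show 0 ≤ Real.cos (n * Real.pi) * d x by linarith), abs_mul,
    abs_cos_int_mul_pi, one_mul]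

theorem IsNearCosine.sign_mul_deriv2_neg (h : IsNearCosine d d1 d2 T ε R) {n : ℤ}
    (hR : R ≤ archLeft T n) {x : ℝ} (hx : x ∈ Icc (archLeft T n) (archRight T n)) :
    Real.cos (n * Real.pi) * d2 x < 0 := by
  have h1 : |Real.cos (n * Real.pi) * d2 x
      + 2 * T ^ 2 * (Real.cos (n * Real.pi) * Real.cos (x * T))| ≤ T ^ 2 * ε := by
    have := h.near_deriv2 x (hR.trans hx.1)
    calc _ = |Real.cos (n * Real.pi) * (d2 x + 2 * T ^ 2 * Real.cos (x * T))| := by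
          congr 1; ring
      _ ≤ T ^ 2 * ε := by rwa [abs_mul, abs_cos_int_mul_pi, one_mul]
  have h2 := half_le_cos_of_mem_arch h.T_pos hx
  have h3 := (abs_le.mp h1).2
  have hT2 : 0 < T ^ 2 := pow_pos h.T_pos 2
  nlinarith [h.ε_le]

theorem IsNearCosine.sign_mul_hasDerivAt (h : IsNearCosine d d1 d2 T ε R) (n : ℤ) :
    (∀ x, HasDerivAt (fun x => Real.cos (n * Real.pi) * d x) (Real.cos (n * Real.pi) * d1 x) x) ∧
    (∀ x, HasDerivAt (fun x => Real.cos (n * Real.pi) * d1 x)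
      (Real.cos (n * Real.pi) * d2 x) x) :=
  ⟨fun x => (h.hasDerivAt x).const_mul _, fun x => (h.hasDerivAt_deriv x).const_mul _⟩

/-- At such points the model 2cos(xT) has squared derivative 3T² and 4 - d² = 3, so the second
quantity is about 3T²(1 - C). The errors turn these values into at most T²(3 + 4ε) and at least 4 -
(1 + ε)², and `hC` says that ε is small enough to keep the sign. -/
theorem IsNearCosine.bounds_of_cos_eq (h : IsNearCosine d d1 d2 T ε R) (hε : 0 < ε) {C : ℝ}
    (hC : ε * (5 + 3 * C) ≤ C - 1) {x : ℝ} (hx : R ≤ x)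
    (hcos : |Real.cos (x * T)| = 1 / 2) :
    |d x| < 2 ∧ d1 x ^ 2 - C * T ^ 2 * (4 - d x ^ 2) < 0 := by
  -- If -5/3 < C ≤ 1, the left side of `hC` is positive and the right side is not; if C ≤ -5/3, then
  -- ε ≤ 1/3 bounds the left side below by 5/3 + C > C - 1.
  have hC1 : 1 < C := by
    by_contra! hcon
    nlinarith [h.ε_le]
  have hT := h.T_pos
  have hsin : |Real.sin (x * T)| ≤ 7 / 8 := by
    rw [← abs_of_nonneg (show (0 : ℝ) ≤ 7 / 8 by norm_num), ← sq_le_sq]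
    have e1 := Real.sin_sq_add_cos_sq (x * T)
    have e2 : Real.cos (x * T) ^ 2 = 1 / 4 := by rw [← sq_abs, hcos]; norm_num
    nlinarith
  have h0 : |d x| ≤ 1 + ε := by
    calc |d x| = |(d x - 2 * Real.cos (x * T)) + 2 * Real.cos (x * T)| := by
          rw [sub_add_cancel]
      _ ≤ |d x - 2 * Real.cos (x * T)| + |2 * Real.cos (x * T)| := abs_add_le _ _
      _ ≤ ε + 1 := by
          rw [abs_mul, hcos]
          have := h.near x hx
          norm_num
          linarith
      _ = 1 + ε := by ring
  have hs3 : Real.sin (x * T) ^ 2 = 3 / 4 := by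
    have e1 := Real.sin_sq_add_cos_sq (x * T)
    have e2 : Real.cos (x * T) ^ 2 = 1 / 4 := by rw [← sq_abs, hcos]; norm_num
    linarith
  have h1 : d1 x ^ 2 ≤ T ^ 2 * (3 + 4 * ε) := by
    set w := d1 x + 2 * T * Real.sin (x * T) with hw
    have hw1 : |w| ≤ T * ε := h.near_deriv x hx
    have e3 : d1 x = w - 2 * T * Real.sin (x * T) := by rw [hw]; ring
    have e4 : d1 x ^ 2 = w ^ 2 - 4 * T * (w * Real.sin (x * T)) + T ^ 2 * 3 := by
      rw [e3]; linear_combination 4 * T ^ 2 * hs3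
    have e5 : |w * Real.sin (x * T)| ≤ T * ε * (7 / 8) := by
      rw [abs_mul]
      exact mul_le_mul hw1 hsin (abs_nonneg _) (by positivity)
    have e6 : w ^ 2 ≤ (T * ε) ^ 2 := by
      rw [← sq_abs]
      exact pow_le_pow_left₀ (abs_nonneg _) hw1 2
    have e7 := (abs_le.mp e5).1
    have e8 : T * (w * Real.sin (x * T)) ≥ -(T * (T * ε * (7 / 8))) := by nlinarith
    have e9 : ε ^ 2 ≤ ε * (1 / 3) := by nlinarith [h.ε_le]
    have e10 : T ^ 2 * ε ^ 2 ≤ T ^ 2 * (ε * (1 / 3)) := by gcongr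
    have e11 : 0 ≤ T ^ 2 * ε := by positivity
    rw [e4]
    nlinarith
  have h2 : d x ^ 2 ≤ (1 + ε) ^ 2 := by
    rw [← sq_abs]
    exact pow_le_pow_left₀ (abs_nonneg _) h0 2
  refine ⟨by linarith [h.ε_le], ?_⟩
  have h3 : (3 + 4 * ε) - C * (4 - (1 + ε) ^ 2) < 0 := by
    have e9 : ε ^ 2 ≤ ε * (1 / 3) := by nlinarith [h.ε_le]
    have e10 : C * ε ^ 2 ≤ C * (ε * (1 / 3)) := by gcongr
    nlinarith
  have h4 : C * T ^ 2 * (4 - (1 + ε) ^ 2) ≤ C * T ^ 2 * (4 - d x ^ 2) := by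
    have : 0 < C * T ^ 2 := by positivity
    nlinarith
  have h5 : T ^ 2 * ((3 + 4 * ε) - C * (4 - (1 + ε) ^ 2)) < 0 :=
    mul_neg_of_pos_of_neg (by positivity) h3
  nlinarith

theorem abs_cos_archRight (hT : 0 < T) (n : ℤ) : |Real.cos (archRight T n * T)| = 1 / 2 := by
  rw [archRight, div_mul_cancel₀ _ hT.ne', Real.cos_add, Real.sin_int_mul_pi, zero_mul, sub_zero,
    abs_mul, abs_cos_int_mul_pi, Real.cos_pi_div_three]
  norm_num

theorem abs_cos_archLeft (hT : 0 < T) (n : ℤ) : |Real.cos (archLeft T n * T)| = 1 / 2 := by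
  rw [archLeft, div_mul_cancel₀ _ hT.ne', Real.cos_sub, Real.sin_int_mul_pi, zero_mul, add_zero,
    abs_mul, abs_cos_int_mul_pi, Real.cos_pi_div_three]
  norm_num

theorem archLeft_lt_archRight (hT : 0 < T) (n : ℤ) : archLeft T n < archRight T n := by
  rw [archLeft, archRight]
  gcongr
  linarith [Real.pi_pos]

/-- An interval of instability of `d` at high frequency lies in an arch. -/
theorem IsNearCosine.exists_arch (h : IsNearCosine d d1 d2 T ε R) {a b : ℝ} (hab : a < b)
    (hRa : R + Real.pi / T ≤ a) (ha : |d a| ≤ 2) (hb : |d b| ≤ 2)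
    (hgap : ∀ x ∈ Ioo a b, 2 < |d x|) :
    ∃ n : ℤ, R ≤ archLeft T n ∧ a ∈ Icc (archLeft T n) (archRight T n) ∧
      b ∈ Icc (archLeft T n) (archRight T n) ∧
      Real.cos (n * Real.pi) * d a = 2 ∧ Real.cos (n * Real.pi) * d b = 2 := by
  have hT := h.T_pos
  have hπ := Real.pi_pos
  have hdc : Continuous fun x => |d x| :=
    (continuous_iff_continuousAt.mpr fun x => (h.hasDerivAt x).continuousAt).abs
  have hcl : Icc a b ⊆ {x | 2 ≤ |d x|} := by
    rw [← closure_Ioo hab.ne]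
    exact closure_minimal (fun x hx => (hgap x hx).le) (isClosed_le continuous_const hdc)
  have ha2 : |d a| = 2 := le_antisymm ha (hcl (left_mem_Icc.mpr hab.le))
  have hb2 : |d b| = 2 := le_antisymm hb (hcl (right_mem_Icc.mpr hab.le))
  have hpT : 0 < Real.pi / T := by positivity
  set m := (a + b) / 2 with hm
  have ham : a < m := by rw [hm]; linarith
  have hmb : m < b := by rw [hm]; linarith
  have hRm : R ≤ m := by linarith
  -- The arch is the one nearest to the midpoint m. Were the phase of m at distance at least π/3
  -- from nπ, then |cos(mT)| ≤ 1/2 and |d m| ≤ 1 + ε < 2.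
  set n : ℤ := round (m * T / Real.pi) with hn
  have hround : |m * T - n * Real.pi| ≤ Real.pi / 2 := by
    have h1 := abs_sub_round (m * T / Real.pi)
    rw [← hn] at h1
    have h2 : m * T - n * Real.pi = (m * T / Real.pi - n) * Real.pi := by field_simp
    rw [h2, abs_mul, abs_of_pos hπ]
    nlinarith
  have hsmall : |m * T - n * Real.pi| < Real.pi / 3 := by
    by_contra! hcon
    have h1 := Real.cos_le_cos_of_nonneg_of_le_pi (by positivity) (by linarith) hcon
    rw [Real.cos_abs, Real.cos_pi_div_three, cos_sub_int_mul_pi_eq] at h1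
    have h2 : 0 ≤ Real.cos (m * T - n * Real.pi) :=
      Real.cos_nonneg_of_mem_Icc (abs_le.mp hround)
    rw [cos_sub_int_mul_pi_eq] at h2
    have h3 := abs_le.mp (h.abs_sign_mul_sub n hRm)
    have h4 := hgap m ⟨ham, hmb⟩
    rw [← one_mul |d m|, ← abs_cos_int_mul_pi n, ← abs_mul] at h4
    have h5 : |Real.cos (n * Real.pi) * d m| ≤ 2 :=
      abs_le.mpr ⟨by linarith [h.ε_le, h3.1], by linarith [h.ε_le, h3.2]⟩
    linarith
  rw [abs_lt] at hsmall
  have hLm : archLeft T n < m := by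
    rw [archLeft, div_lt_iff₀ hT]; linarith
  have hmR : m < archRight T n := by
    rw [archRight, lt_div_iff₀ hT]; linarith
  -- The margin π/T in `hRa` pays for the width 2π/(3T) of the arch, so that the estimates hold on
  -- all of it.
  have hwidth : archRight T n - archLeft T n ≤ Real.pi / T := by
    rw [archRight, archLeft, ← sub_div]
    gcongr
    linarith
  have hRL : R ≤ archLeft T n := by linarith
  have hedge : ∀ x, R ≤ x → |Real.cos (x * T)| = 1 / 2 → |d x| < 2 := by
    intro x hx hcos
    have h1 := h.near x hx
    have h2 : |d x| ≤ |d x - 2 * Real.cos (x * T)| + |2 * Real.cos (x * T)| := by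
      simpa using abs_add_le (d x - 2 * Real.cos (x * T)) (2 * Real.cos (x * T))
    rw [abs_mul, hcos] at h2
    norm_num at h2
    linarith [h.ε_le]
  have haL : archLeft T n ≤ a := by
    by_contra! hcon
    exact (hedge _ hRL (abs_cos_archLeft hT n)).not_ge
      (hgap _ ⟨hcon, by linarith⟩).le
  have hbR : b ≤ archRight T n := by
    by_contra! hcon
    exact (hedge _ (by linarith) (abs_cos_archRight hT n)).not_ge
      (hgap _ ⟨by linarith, hcon⟩).le
  have haI : a ∈ Icc (archLeft T n) (archRight T n) := ⟨haL, by linarith⟩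
  have hbI : b ∈ Icc (archLeft T n) (archRight T n) := ⟨by linarith, hbR⟩
  exact ⟨n, hRL, haI, hbI, by rw [← h.abs_eq hRL haI, ha2], by rw [← h.abs_eq hRL hbI, hb2]⟩

theorem IsNearCosine.arch_unique (h : IsNearCosine d d1 d2 T ε R) {n : ℤ} {a b a' b' : ℝ}
    (hR : R ≤ archLeft T n)
    (ha : a ∈ Icc (archLeft T n) (archRight T n)) (hb : b ∈ Icc (archLeft T n) (archRight T n))
    (hab : a < b) (ha2 : Real.cos (n * Real.pi) * d a = 2) (hb2 : Real.cos (n * Real.pi) * d b = 2)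
    (ha' : a' ∈ Icc (archLeft T n) (archRight T n))
    (hb' : b' ∈ Icc (archLeft T n) (archRight T n)) (hab' : a' < b')
    (ha2' : Real.cos (n * Real.pi) * d a' = 2) (hb2' : Real.cos (n * Real.pi) * d b' = 2) :
    a = a' ∧ b = b' :=
  eq_of_concave (h.sign_mul_hasDerivAt n).1 (h.sign_mul_hasDerivAt n).2
    (fun _ hx => h.sign_mul_deriv2_neg hR hx) ha hb hab ha2 hb2 ha' hb' hab' ha2' hb2'

/-- On either side of an interval of instability, the phase speed takes the value `√C`. -/
theorem IsNearCosine.exists_critical (h : IsNearCosine d d1 d2 T ε R) (hε : 0 < ε) {C : ℝ}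
    (hC : ε * (5 + 3 * C) ≤ C - 1) {n : ℤ} {a b : ℝ} (hR : R ≤ archLeft T n)
    (ha : a ∈ Icc (archLeft T n) (archRight T n)) (hb : b ∈ Icc (archLeft T n) (archRight T n))
    (hab : a < b) (ha2 : Real.cos (n * Real.pi) * d a = 2)
    (hb2 : Real.cos (n * Real.pi) * d b = 2) :
    (∃ x ∈ Ioo b (archRight T n), |d x| < 2 ∧ d1 x ^ 2 = C * T ^ 2 * (4 - d x ^ 2) ∧
      ∀ y ∈ Icc b x, |d y| ≤ 2) ∧
    (∃ x ∈ Ioo (archLeft T n) a, |d x| < 2 ∧ d1 x ^ 2 = C * T ^ 2 * (4 - d x ^ 2) ∧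
      ∀ y ∈ Icc x a, |d y| ≤ 2) := by
  have hT := h.T_pos
  obtain ⟨hout, -, ha1, hb1⟩ := lt_two_of_concave (h.sign_mul_hasDerivAt n).1
    (h.sign_mul_hasDerivAt n).2 (fun _ hx => h.sign_mul_deriv2_neg hR hx) ha hb hab ha2 hb2
  have hout' : ∀ x ∈ Icc (archLeft T n) (archRight T n), x < a ∨ b < x → |d x| < 2 :=
    fun x hx hx' => by rw [h.abs_eq hR hx]; exact hout x hx hx'
  have hLR := archLeft_lt_archRight hT n
  -- G is positive at a and b, where d² = 4 and d' ≠ 0, and negative at both ends of the arch.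
  let G : ℝ → ℝ := fun x => d1 x ^ 2 - C * T ^ 2 * (4 - d x ^ 2)
  have hGc : Continuous G := by
    have c0 : Continuous d := continuous_iff_continuousAt.mpr fun x => (h.hasDerivAt x).continuousAt
    have c1 : Continuous d1 :=
      continuous_iff_continuousAt.mpr fun x => (h.hasDerivAt_deriv x).continuousAt
    fun_prop
  have hGpos : ∀ x, Real.cos (n * Real.pi) * d x = 2 → Real.cos (n * Real.pi) * d1 x ≠ 0 →
      0 < G x := by
    intro x hx hx1
    have e1 : d x ^ 2 = 4 := by
      have := congrArg (· ^ 2) hx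
      simp only [mul_pow, cos_int_mul_pi_sq, one_mul] at this
      rw [this]; norm_num
    have e2 : d1 x ≠ 0 := right_ne_zero_of_mul hx1
    have : G x = d1 x ^ 2 := by simp only [G, e1]; ring
    rw [this]
    positivity
  have hbR : b < archRight T n := by
    refine lt_of_le_of_ne hb.2 ?_
    rintro rfl
    have := (h.bounds_of_cos_eq hε hC (hR.trans hLR.le) (abs_cos_archRight hT n)).1
    rw [h.abs_eq hR (right_mem_Icc.mpr hLR.le), hb2] at this
    exact lt_irrefl _ this
  have hLa : archLeft T n < a := by
    refine lt_of_le_of_ne ha.1 ?_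
    rintro rfl
    have := (h.bounds_of_cos_eq hε hC hR (abs_cos_archLeft hT n)).1
    rw [h.abs_eq hR (left_mem_Icc.mpr hLR.le), ha2] at this
    exact lt_irrefl _ this
  constructor
  · obtain ⟨x, hx, hx0⟩ := intermediate_value_Ioo' hbR.le hGc.continuousOn
      ⟨(h.bounds_of_cos_eq hε hC (hR.trans hLR.le) (abs_cos_archRight hT n)).2,
        hGpos b hb2 hb1⟩
    refine ⟨x, hx, hout' x ⟨hb.1.trans hx.1.le, hx.2.le⟩ (Or.inr hx.1), sub_eq_zero.mp hx0,
      fun y hy => ?_⟩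
    rcases hy.1.eq_or_lt with rfl | hlt
    · rw [h.abs_eq hR hb, hb2]
    · exact (hout' y ⟨hb.1.trans hy.1, hy.2.trans hx.2.le⟩ (Or.inr hlt)).le
  · obtain ⟨x, hx, hx0⟩ := intermediate_value_Ioo hLa.le hGc.continuousOn
      ⟨(h.bounds_of_cos_eq hε hC hR (abs_cos_archLeft hT n)).2, hGpos a ha2 ha1⟩
    refine ⟨x, hx, hout' x ⟨hx.1.le, hx.2.le.trans ha.2⟩ (Or.inl hx.2), sub_eq_zero.mp hx0,
      fun y hy => ?_⟩
    rcases hy.2.eq_or_lt with rfl | hlt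
    · rw [h.abs_eq hR ha, ha2]
    · exact (hout' y ⟨hx.1.le.trans hy.1, hy.2.trans ha.2⟩ (Or.inl hlt)).le

end

/-! ### The potential of the linearization about a traveling wave -/

theorem IsPeriodicTravelingWave.contDiff {V : ℝ → ℝ} {c : ℝ} {f : ℝ → ℝ} {T : ℝ}
    (hf : IsPeriodicTravelingWave V c f T) : ContDiff ℝ 2 f := by
  have h : ContDiff ℝ 2 fun x : ℝ => ((x, 0) : ℝ × ℝ) := by fun_prop
  simpa [Function.comp_def] using hf.solution.1.comp h

theorem IsPeriodicTravelingWave.ode {V : ℝ → ℝ} {c : ℝ} {f : ℝ → ℝ} {T : ℝ}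
    (hf : IsPeriodicTravelingWave V c f T) (x : ℝ) :
    (c ^ 2 - 1) * deriv (deriv f) x + deriv V (f x) = 0 := by
  have hfd : Differentiable ℝ f := hf.contDiff.differentiable (by norm_num)
  have hfd' : Differentiable ℝ (deriv f) := hf.contDiff.differentiable_deriv_two
  have hin : ∀ s : ℝ, HasDerivAt (fun s : ℝ => x - c * s) (-(c * 1)) s := fun s =>
    ((hasDerivAt_id s).const_mul c).const_sub x
  have e1 : (deriv fun s : ℝ => f (x - c * s)) = fun s => deriv f (x - c * s) * (-(c * 1)) :=
    funext fun s => ((hfd _).hasDerivAt.comp s (hin s)).deriv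
  have e2 : deriv (fun s : ℝ => deriv f (x - c * s) * (-(c * 1))) 0
      = deriv (deriv f) (x - c * 0) * (-(c * 1)) * (-(c * 1)) :=
    (((hfd' _).hasDerivAt.comp 0 (hin 0)).mul_const _).deriv
  have h := hf.solution.2 x 0
  rw [e1, e2] at h
  simp only [mul_zero, sub_zero] at h
  linear_combination h

theorem surjective_of_add_eq_add_const {f : ℝ → ℝ} (hf : Continuous f) {T k : ℝ} (hk : k ≠ 0)
    (h : ∀ z, f (z + T) = f z + k) : Function.Surjective f := by
  have hn : ∀ n : ℕ, f (n * T) = f 0 + n * k := by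
    intro n
    induction n with
    | zero => simp
    | succ n ih =>
      push_cast
      rw [add_mul, one_mul, h, ih]; ring
  have hn' : ∀ n : ℕ, f (-(n * T)) = f 0 - n * k := by
    intro n
    induction n with
    | zero => simp
    | succ n ih =>
      have := h (-((n + 1 : ℕ) * T))
      rw [show -((n + 1 : ℕ) * T) + T = -(n * T) by push_cast; ring, ih] at this
      push_cast at this ⊢
      linarith
  intro y
  obtain ⟨n, hny⟩ := exists_nat_gt (|y - f 0| / |k|)
  rw [div_lt_iff₀ (abs_pos.mpr hk)] at hny
  have hy : y ∈ uIcc (f (n * T)) (f (-(n * T))) := by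
    have h1 := abs_le.mp hny.le
    rw [hn, hn', mem_uIcc]
    rcases abs_cases k with ⟨hk', -⟩ | ⟨hk', -⟩
    · rw [hk'] at h1
      right; constructor <;> linarith
    · rw [hk'] at h1
      left; constructor <;> linarith
  obtain ⟨x, -, hx⟩ := intermediate_value_uIcc hf.continuousOn hy
  exact ⟨x, hx⟩

theorem IsPeriodicTravelingWave.exists_add_period {V : ℝ → ℝ} {c : ℝ} {f : ℝ → ℝ} {T : ℝ}
    (hf : IsPeriodicTravelingWave V c f T) : ∃ k, ∀ z, f (z + T) = f z + k := by
  have hfd : Differentiable ℝ f := hf.contDiff.differentiable (by norm_num)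
  have hd : ∀ z, HasDerivAt (fun z => f (z + T) - f z) 0 z := fun z => by
    refine (((hfd (z + T)).hasDerivAt.comp_add_const z T).sub (hfd z).hasDerivAt).congr_deriv ?_
    rw [hf.period.2.1 z, sub_self]
  refine ⟨f (0 + T) - f 0, fun z => ?_⟩
  have := is_const_of_deriv_eq_zero (fun z => (hd z).differentiableAt) (fun z => (hd z).deriv) z 0
  linarith

/-- Only f' is periodic, so f(z + T) = f(z) + k. If k ≠ 0, the profile equation gives V'(y + k) =
V'(y) for y in the range of f, which is all of ℝ; differentiating, V'' has period k. -/
theorem IsPeriodicTravelingWave.periodic_hillPotential {V : ℝ → ℝ} {c : ℝ} {f : ℝ → ℝ} {T : ℝ}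
    (hf : IsPeriodicTravelingWave V c f T) : Function.Periodic (hillPotential V c f) T := by
  obtain ⟨k, hk⟩ := hf.exists_add_period
  intro z
  simp only [hillPotential]
  congr 1
  rw [hk]
  by_cases hk0 : k = 0
  · rw [hk0, add_zero]
  have hsurj := surjective_of_add_eq_add_const hf.contDiff.continuous hk0 hk
  have hV : (fun y => deriv V (y + k)) = deriv V := by
    funext y
    obtain ⟨x, rfl⟩ := hsurj y
    have h1 := hf.ode (x + T)
    have h2 := hf.ode x
    have h3 : deriv (deriv f) (x + T) = deriv (deriv f) x := by
      rw [← deriv_comp_add_const, show (fun z => deriv f (z + T)) = deriv f from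
        funext hf.period.2.1]
    rw [hk, h3] at h1
    linarith
  rw [← deriv_comp_add_const, hV]

theorem IsPeriodicTravelingWave.continuous_hillPotential {V : ℝ → ℝ} (hV : ContDiff ℝ 2 V) {c : ℝ}
    {f : ℝ → ℝ} {T : ℝ} (hf : IsPeriodicTravelingWave V c f T) :
    Continuous (hillPotential V c f) := by
  have h1 : ContDiff ℝ 1 (deriv V) := hV.deriv'
  have h2 : Continuous (deriv (deriv V)) := h1.continuous_deriv le_rfl
  exact (h2.comp hf.contDiff.continuous).div_const _

theorem exists_abs_le_of_periodic {g : ℝ → ℝ} (hg : Continuous g) {T : ℝ} (hT : T ≠ 0)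
    (hp : Function.Periodic g T) : ∃ M, 0 < M ∧ ∀ z, |g z| ≤ M := by
  obtain ⟨M, hM⟩ := (hp.compact_of_continuous hT hg).isBounded.exists_norm_le
  exact ⟨|M| + 1, by positivity, fun z =>
    (hM _ (mem_range_self z)).trans ((le_abs_self M).trans (by linarith))⟩

/-! ### From Hill's equation to the spectrum of the wave -/

/-- The root ρ = e^{i(θ - cTω)} satisfies ρ + 1/ρ = D, so it has a Floquet solution y. For w =
e^{icωz}y the multiplier is e^{iθ}; thus |w| is continuous and periodic, hence bounded. -/
theorem IsHillSystem.mem_floquetSpectrum {V : ℝ → ℝ} {c : ℝ} (hc : 1 < c ^ 2) {f : ℝ → ℝ} {T : ℝ}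
    (hT : T ≠ 0) (hP : Function.Periodic (hillPotential V c f) T) {y₁ y₂ : ℂ → ℝ → ℂ}
    (h : IsHillSystem (hillPotential V c f) y₁ y₂) {ω : ℂ} {θ : ℝ}
    (hθ : 2 * Complex.cos (θ - ((c * T : ℝ) : ℂ) * ω) = frequencyDiscriminant y₁ y₂ T ω) :
    Complex.I * ((c : ℂ) ^ 2 - 1) * ω ∈ floquetSpectrum V c f := by
  have hc1 : (c : ℂ) ^ 2 - 1 ≠ 0 := by
    have : (c ^ 2 - 1 : ℝ) ≠ 0 := by linarith
    exact_mod_cast this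
  set ρ : ℂ := Complex.exp ((θ - ((c * T : ℝ) : ℂ) * ω) * Complex.I) with hρ
  have hρeq : ρ ^ 2 - hillDiscriminant y₁ y₂ T (-ω ^ 2) * ρ + 1 = 0 := by
    have h1 : ρ * Complex.exp (-(θ - ((c * T : ℝ) : ℂ) * ω) * Complex.I) = 1 := by
      rw [hρ, ← Complex.exp_add, neg_mul, add_neg_cancel, Complex.exp_zero]
    change ρ ^ 2 - frequencyDiscriminant y₁ y₂ T ω * ρ + 1 = 0
    rw [← hθ, Complex.two_cos, ← hρ]
    linear_combination -h1
  obtain ⟨y, hy, ⟨z₀, hz₀⟩, hyT⟩ := h.exists_floquet_solution hP hρeq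
  let κ : ℂ := Complex.I * c * ω
  let e : ℝ → ℂ := fun z => Complex.exp (κ * z)
  have hde : ∀ z, HasDerivAt e (κ * e z) z := fun z => by
    have h : HasDerivAt (fun z : ℝ => κ * (z : ℂ)) (κ * 1) z :=
      (hasDerivAt_id z).ofReal_comp.const_mul _
    refine h.cexp.congr_deriv ?_
    simp only [e]; ring
  let w : ℝ → ℂ := fun z => e z * y z
  have hw : ∀ z, HasDerivAt w (e z * (deriv y z + κ * y z)) z := fun z =>
    ((hde z).mul (hy.hasDerivAt z)).congr_deriv (by ring)
  have hw1 : deriv w = fun z => e z * (deriv y z + κ * y z) := funext fun z => (hw z).deriv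
  have hw' : ∀ z, HasDerivAt (deriv w) (κ * e z * (deriv y z + κ * y z)
      + e z * ((-ω ^ 2 - hillPotential V c f z) * y z + κ * deriv y z)) z := fun z => by
    rw [hw1]
    exact (hde z).mul ((hy.hasDerivAt_deriv z).add ((hy.hasDerivAt z).const_mul κ))
  refine ⟨w, ⟨fun z => (hw z).differentiableAt, fun z => (hw' z).differentiableAt, fun z => ?_⟩,
    ⟨z₀, mul_ne_zero (Complex.exp_ne_zero _) hz₀⟩, ?_⟩
  · have hPz : (hillPotential V c f z : ℂ) * ((c : ℂ) ^ 2 - 1)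
        = ((deriv (deriv V) (f z) : ℝ) : ℂ) := by
      simp only [hillPotential]
      push_cast
      field_simp
    rw [(hw' z).deriv, hw1, ← hPz]
    simp only [w, κ]
    linear_combination ((c : ℂ) ^ 2 - 1) * ω ^ 2 * e z * y z * (-1) * Complex.I_sq
  · have hper : Function.Periodic (fun z => ‖w z‖) T := by
      intro z
      have h1 : e (z + T) * ρ = e z * Complex.exp (θ * Complex.I) := by
        simp only [e, hρ, ← Complex.exp_add, κ]
        congr 1
        push_cast
        ring
      have h2 : w (z + T) = Complex.exp (θ * Complex.I) * w z := by
        simp only [w, hyT]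
        linear_combination y z * h1
      change ‖w (z + T)‖ = ‖w z‖
      rw [h2, norm_mul, Complex.norm_exp_ofReal_mul_I, one_mul]
    have hcont : Continuous fun z => ‖w z‖ :=
      (continuous_iff_continuousAt.mpr fun z => (hw z).continuousAt).norm
    obtain ⟨B, -, hB⟩ := exists_abs_le_of_periodic hcont hT hper
    exact ⟨B, fun z => (le_abs_self _).trans (hB z)⟩

theorem IsHillSystem.frequencyDiscriminant_conj {P : ℝ → ℝ} {y₁ y₂ : ℂ → ℝ → ℂ}
    (h : IsHillSystem P y₁ y₂) (T : ℝ) (ω : ℂ) :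
    frequencyDiscriminant y₁ y₂ T (starRingEnd ℂ ω)
      = starRingEnd ℂ (frequencyDiscriminant y₁ y₂ T ω) := by
  simp only [frequencyDiscriminant, ← h.hillDiscriminant_conj, map_neg, map_pow]

theorem IsHillSystem.frequencyDiscriminant_ofReal {P : ℝ → ℝ} {y₁ y₂ : ℂ → ℝ → ℂ}
    (h : IsHillSystem P y₁ y₂) (T x : ℝ) :
    frequencyDiscriminant y₁ y₂ T x = ((frequencyDiscriminant y₁ y₂ T x).re : ℂ) := by
  have := h.frequencyDiscriminant_conj T x
  rw [Complex.conj_ofReal] at this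
  exact (Complex.conj_eq_iff_re.mp this.symm).symm

theorem IsHillSystem.deriv_frequencyDiscriminant_ofReal {P : ℝ → ℝ} {y₁ y₂ : ℂ → ℝ → ℂ}
    (h : IsHillSystem P y₁ y₂) {T : ℝ} (hD : Differentiable ℂ (frequencyDiscriminant y₁ y₂ T))
    (x : ℝ) : deriv (frequencyDiscriminant y₁ y₂ T) x
      = ((deriv (frequencyDiscriminant y₁ y₂ T) x).re : ℂ) := by
  have h1 := (hD x).hasDerivAt.comp_ofReal
  have h2 := (hD x).hasDerivAt.real_of_complex.ofReal_comp
  simp only [← h.frequencyDiscriminant_ofReal] at h2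
  exact h1.unique h2

theorem IsHillSystem.neg_sq_mem_hillSpectrum_iff {P : ℝ → ℝ} {y₁ y₂ : ℂ → ℝ → ℂ}
    (h : IsHillSystem P y₁ y₂) (T x : ℝ) :
    (-(x : ℂ) ^ 2) ∈ hillSpectrum P T ↔ |(frequencyDiscriminant y₁ y₂ T x).re| ≤ 2 :=
  h.mem_hillSpectrum_iff (h.frequencyDiscriminant_ofReal T x)

/-- By `hcrit` the point D/2 + iD'/(2cT) is on the unit circle. Its argument θ₀ satisfies D = 2cos
θ₀ and D' = 2cT sin θ₀, with the correct sign of the sine, as `exists_nonreal_phase` requires; |D| <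
2 gives sin θ₀ ≠ 0. Multiplication by i(c² - 1) carries nonreal ω to λ off the imaginary axis. -/
theorem IsHillSystem.isDynamicalHamiltonianHopf {V : ℝ → ℝ} {c : ℝ} (hc : 1 < c ^ 2) {f : ℝ → ℝ}
    {T : ℝ} (hT : T ≠ 0) (hP : Function.Periodic (hillPotential V c f) T) {y₁ y₂ : ℂ → ℝ → ℂ}
    (h : IsHillSystem (hillPotential V c f) y₁ y₂)
    (hD : Differentiable ℂ (frequencyDiscriminant y₁ y₂ T)) {x : ℝ} (hx : x ≠ 0)
    (h2 : |(frequencyDiscriminant y₁ y₂ T x).re| < 2)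
    (hcrit : (deriv (frequencyDiscriminant y₁ y₂ T) x).re ^ 2
      = c ^ 2 * T ^ 2 * (4 - (frequencyDiscriminant y₁ y₂ T x).re ^ 2)) :
    IsDynamicalHamiltonianHopf V c f (Complex.I * ((x * (c ^ 2 - 1) : ℝ) : ℂ)) := by
  have hc1 : c ^ 2 - 1 ≠ 0 := by linarith
  have hc0 : c ≠ 0 := by rintro rfl; norm_num at hc
  have h0 := h.frequencyDiscriminant_ofReal T x
  have h1 := h.deriv_frequencyDiscriminant_ofReal hD x
  set D := frequencyDiscriminant y₁ y₂ T
  set d := (D x).re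
  set d' := (deriv D x).re
  have hd4 : d ^ 2 < 4 := by
    have := sq_lt_sq' (abs_lt.mp h2).1 (abs_lt.mp h2).2
    linarith
  have hcT : c * T ≠ 0 := mul_ne_zero hc0 hT
  let ζ : ℂ := ⟨d / 2, d' / (2 * (c * T))⟩
  have hζ : ‖ζ‖ = 1 := by
    rw [Complex.norm_def, Complex.normSq_mk, Real.sqrt_eq_one]
    field_simp
    linear_combination hcrit
  have hζ0 : ζ ≠ 0 := by
    intro h0
    rw [h0, norm_zero] at hζ
    exact zero_ne_one hζ
  have hcos : Real.cos ζ.arg = d / 2 := by rw [Complex.cos_arg hζ0, hζ, div_one]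
  have hsin : Real.sin ζ.arg = d' / (2 * (c * T)) := by rw [Complex.sin_arg, hζ, div_one]
  have hsin0 : Real.sin ζ.arg ≠ 0 := by
    intro h0
    have := Real.sin_sq_add_cos_sq ζ.arg
    rw [h0, hcos] at this
    nlinarith
  refine ⟨?_, by rw [Complex.I_mul_re, Complex.ofReal_im, neg_zero], fun U hU => ?_⟩
  · simp only [ne_eq, mul_eq_zero, Complex.I_ne_zero, false_or, Complex.ofReal_eq_zero]
    push Not
    exact ⟨hx, hc1⟩
  have hcont : Continuous fun ω : ℂ => Complex.I * ((c : ℂ) ^ 2 - 1) * ω := by fun_prop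
  have hU' : (fun ω : ℂ => Complex.I * ((c : ℂ) ^ 2 - 1) * ω) ⁻¹' U ∈ 𝓝 (x : ℂ) := by
    refine hcont.continuousAt.preimage_mem_nhds ?_
    rwa [show Complex.I * ((c : ℂ) ^ 2 - 1) * x = Complex.I * ((x * (c ^ 2 - 1) : ℝ) : ℂ) by
      push_cast; ring]
  obtain ⟨ω, hωU, him, θ, hθ⟩ := exists_nonreal_phase hD (h.frequencyDiscriminant_conj T)
    (k := c * T) (θ₀ := ζ.arg)
    (by rw [h0, ← Complex.ofReal_cos, hcos]; push_cast; ring)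
    (by
      rw [h1, ← Complex.ofReal_sin, hsin]
      norm_cast
      field_simp)
    hsin0 hU'
  refine ⟨Complex.I * ((c : ℂ) ^ 2 - 1) * ω, ⟨h.mem_floquetSpectrum hc hT hP hθ, hωU⟩, ?_⟩
  have hre : (Complex.I * ((c : ℂ) ^ 2 - 1) * ω).re = -((c ^ 2 - 1) * ω.im) := by
    rw [mul_assoc, show (c : ℂ) ^ 2 - 1 = ((c ^ 2 - 1 : ℝ) : ℂ) by push_cast; ring,
      Complex.I_mul_re, Complex.im_ofReal_mul]
  simp only [mem_ofPred_eq, hre, neg_eq_zero, mul_eq_zero]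
  push Not
  exact ⟨hc1, him⟩

theorem hillParameter_I_mul {c : ℝ} (hc : 1 < c ^ 2) (x : ℝ) :
    hillParameter c (Complex.I * ((x * (c ^ 2 - 1) : ℝ) : ℂ)) = -(x : ℂ) ^ 2 := by
  have hc1 : (c : ℂ) ^ 2 - 1 ≠ 0 := by
    have : (c ^ 2 - 1 : ℝ) ≠ 0 := by linarith
    exact_mod_cast this
  rw [hillParameter]
  push_cast
  rw [← mul_assoc, mul_div_assoc, div_self hc1, mul_one, mul_pow, Complex.I_sq]
  ring

theorem neg_sq_mem_band {S : Set ℂ} {a b x y ν : ℝ} (hx : x ∈ Icc a b) (hy : y ∈ Icc a b)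
    (hS : ∀ z ∈ Icc a b, -(z : ℂ) ^ 2 ∈ S) (hν : ν = -y ^ 2) : -(x : ℂ) ^ 2 ∈ band S ν := by
  have hpre : IsPreconnected ((fun z : ℝ => -(z : ℂ) ^ 2) '' Icc a b) :=
    isPreconnected_Icc.image _ (Continuous.continuousOn (by fun_prop))
  refine hpre.subset_connectedComponentIn ⟨y, hy, by rw [hν]; push_cast; ring⟩ ?_ ⟨x, hx, rfl⟩
  rintro _ ⟨z, hz, rfl⟩
  exact hS z hz

/-! ### Assembly of the theorem -/

theorem IsHillSystem.exists_isNearCosine {P : ℝ → ℝ} {y₁ y₂ : ℂ → ℝ → ℂ}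
    (h : IsHillSystem P y₁ y₂) (hP : Continuous P) {M T : ℝ} (hM0 : 0 < M)
    (hM : ∀ z, |P z| ≤ M) (hT : 0 < T) {ε : ℝ} (hε : 0 < ε) (hε3 : ε ≤ 1 / 3) :
    ∃ R, 0 < R ∧ IsNearCosine (fun x => (frequencyDiscriminant y₁ y₂ T x).re)
      (fun x => (deriv (frequencyDiscriminant y₁ y₂ T) x).re)
      (fun x => (deriv (deriv (frequencyDiscriminant y₁ y₂ T)) x).re) T ε R := by
  have hD := h.differentiable_frequencyDiscriminant hP hM T
  obtain ⟨R, hR, hasy⟩ := h.frequencyDiscriminant_asymptotics hP hM0 hM hT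
    (ε := min ε (min (T * ε) (T ^ 2 * ε))) (by positivity)
  refine ⟨R, hR, ⟨fun x => (hD x).hasDerivAt.real_of_complex, fun x =>
    (((hD.analyticAt x).deriv).differentiableAt).hasDerivAt.real_of_complex, hT, hε3,
    fun x hx => ?_, fun x hx => ?_, fun x hx => ?_⟩⟩
  · refine le_trans (le_of_eq ?_) (((Complex.abs_re_le_norm _).trans (hasy x hx).1).trans
      (min_le_left _ _))
    rw [show 2 * Complex.cos (x * T) = ((2 * Real.cos (x * T) : ℝ) : ℂ) by
      push_cast; rfl, Complex.sub_re, Complex.ofReal_re]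
  · refine le_trans (le_of_eq ?_) (((Complex.abs_re_le_norm _).trans (hasy x hx).2.1).trans
      ((min_le_right _ _).trans (min_le_left _ _)))
    rw [show 2 * T * Complex.sin (x * T) = ((2 * T * Real.sin (x * T) : ℝ) : ℂ) by
      push_cast; rfl, Complex.add_re, Complex.ofReal_re]
  · refine le_trans (le_of_eq ?_) (((Complex.abs_re_le_norm _).trans (hasy x hx).2.2).trans
      ((min_le_right _ _).trans (min_le_right _ _)))
    rw [show 2 * T ^ 2 * Complex.cos (x * T) = ((2 * T ^ 2 * Real.cos (x * T) : ℝ) : ℂ) by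
      push_cast; rfl, Complex.add_re, Complex.ofReal_re]

/-- Arches have half-width π/3 in phase and centers π apart. -/
theorem arch_index_unique {T x : ℝ} (hT : 0 < T) {m n : ℤ}
    (hm : x ∈ Icc (archLeft T m) (archRight T m)) (hn : x ∈ Icc (archLeft T n) (archRight T n)) :
    m = n := by
  have hπ := Real.pi_pos
  simp only [archLeft, archRight, mem_Icc, div_le_iff₀ hT, le_div_iff₀ hT] at hm hn
  have h1 : (m : ℝ) < n + 1 := by
    by_contra! hcon
    nlinarith
  have h2 : (n : ℝ) < m + 1 := by
    by_contra! hcon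
    nlinarith
  have h1' : m < n + 1 := by exact_mod_cast h1
  have h2' : n < m + 1 := by exact_mod_cast h2
  omega

theorem corollary4 (V : ℝ → ℝ) (hV : ContDiff ℝ 2 V) (c : ℝ) (hc : 1 < c ^ 2)
    (f : ℝ → ℝ) (T : ℝ) (hf : IsPeriodicTravelingWave V c f T) :
    ∃ N : ℝ,
      ∃ lo hi : {g : ℝ × ℝ // IsOpenGap (hillSpectrum (hillPotential V c f) T) g ∧ g.2 < -N} → ℝ,
        (∀ g, 0 < lo g ∧
          IsDynamicalHamiltonianHopf V c f (Complex.I * (lo g : ℂ)) ∧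
          hillParameter c (Complex.I * (lo g : ℂ)) ∈
            band (hillSpectrum (hillPotential V c f) T) g.1.1) ∧
        (∀ g, 0 < hi g ∧
          IsDynamicalHamiltonianHopf V c f (Complex.I * (hi g : ℂ)) ∧
          hillParameter c (Complex.I * (hi g : ℂ)) ∈
            band (hillSpectrum (hillPotential V c f) T) g.1.2) ∧
        Function.Injective (Sum.elim lo hi) := by
  have hT : 0 < T := hf.period.1
  have hc1 : 0 < c ^ 2 - 1 := by linarith
  have hPc := hf.continuous_hillPotential hV
  have hPp := hf.periodic_hillPotential
  obtain ⟨M, hM0, hM⟩ := exists_abs_le_of_periodic hPc hT.ne' hPp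
  obtain ⟨y₁, y₂, h⟩ := exists_isHillSystem _ hPc hM
  have hD := h.differentiable_frequencyDiscriminant hPc hM T
  have hden : 0 < 5 + 3 * c ^ 2 := by positivity
  -- The largest ε allowed by the condition ε(5 + 3C) ≤ C - 1 with C = c²; it is below 1/3
  -- automatically.
  set ε : ℝ := (c ^ 2 - 1) / (5 + 3 * c ^ 2) with hε
  have hε0 : 0 < ε := by positivity
  have hεC : ε * (5 + 3 * c ^ 2) ≤ c ^ 2 - 1 := by rw [hε, div_mul_cancel₀ _ hden.ne']
  have hε3 : ε ≤ 1 / 3 := by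
    rw [hε, div_le_iff₀ hden]; linarith
  obtain ⟨R, hR, hnear⟩ := h.exists_isNearCosine hPc hM0 hM hT hε0 hε3
  have hmem := h.neg_sq_mem_hillSpectrum_iff T
  set S := hillSpectrum (hillPotential V c f) T with hS
  set d : ℝ → ℝ := fun x => (frequencyDiscriminant y₁ y₂ T x).re with hd
  have hRT : 0 < R + Real.pi / T := by positivity
  -- Since ν = -ω² reverses order, the right end β is -a² with the smaller frequency a and the left
  -- end α is -b². The bound on β is a square so that it gives a ≥ R + π/T.
  have key : ∀ g : {g : ℝ × ℝ // IsOpenGap S g ∧ g.2 < -(R + Real.pi / T) ^ 2},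
      ∃ (n : ℤ) (a b xlo xhi : ℝ), g.1.2 = -a ^ 2 ∧ g.1.1 = -b ^ 2 ∧ R ≤ archLeft T n ∧
        a ∈ Icc (archLeft T n) (archRight T n) ∧ b ∈ Icc (archLeft T n) (archRight T n) ∧
        a < b ∧ Real.cos (n * Real.pi) * d a = 2 ∧ Real.cos (n * Real.pi) * d b = 2 ∧
        xlo ∈ Ioo b (archRight T n) ∧ xhi ∈ Ioo (archLeft T n) a ∧
        (IsDynamicalHamiltonianHopf V c f (Complex.I * ((xlo * (c ^ 2 - 1) : ℝ) : ℂ)) ∧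
          -(xlo : ℂ) ^ 2 ∈ band S g.1.1) ∧
        (IsDynamicalHamiltonianHopf V c f (Complex.I * ((xhi * (c ^ 2 - 1) : ℝ) : ℂ)) ∧
          -(xhi : ℂ) ^ 2 ∈ band S g.1.2) := by
    rintro ⟨⟨α, β⟩, ⟨hαβ, hα, hβ, hgap⟩, hβN⟩
    simp only at hαβ hα hβ hgap hβN ⊢
    have hβ0 : 0 < -β := by nlinarith
    set a := Real.sqrt (-β) with ha
    set b := Real.sqrt (-α) with hb
    have ha2 : a ^ 2 = -β := Real.sq_sqrt hβ0.le
    have hb2 : b ^ 2 = -α := Real.sq_sqrt (by linarith)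
    have hab : a < b := Real.sqrt_lt_sqrt hβ0.le (by linarith)
    have hRa : R + Real.pi / T ≤ a := Real.le_sqrt_of_sq_le (by linarith)
    have hcastβ : (β : ℂ) = -(a : ℂ) ^ 2 := by
      rw [← Complex.ofReal_pow, ha2]; simp
    have hcastα : (α : ℂ) = -(b : ℂ) ^ 2 := by
      rw [← Complex.ofReal_pow, hb2]; simp
    have hda : |d a| ≤ 2 := (hmem a).mp (hcastβ ▸ hβ)
    have hdb : |d b| ≤ 2 := (hmem b).mp (hcastα ▸ hα)
    have hgap' : ∀ x ∈ Ioo a b, 2 < |d x| := by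
      intro x hx
      by_contra! hcon
      have h1 := (hmem x).mpr hcon
      rw [show -(x : ℂ) ^ 2 = ((-x ^ 2 : ℝ) : ℂ) by push_cast; ring] at h1
      refine hgap _ ⟨?_, ?_⟩ h1
      · nlinarith [hx.1, hx.2]
      · nlinarith [hx.1, hx.2]
    obtain ⟨n, hRn, haI, hbI, hda2, hdb2⟩ := hnear.exists_arch hab hRa hda hdb hgap'
    obtain ⟨⟨xlo, hlo, hlo2, hloc, hloS⟩, ⟨xhi, hhi, hhi2, hhic, hhiS⟩⟩ :=
      hnear.exists_critical hε0 hεC hRn haI hbI hab hda2 hdb2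
    have hxlo : 0 < xlo := by linarith [hlo.1]
    have hxhi : 0 < xhi := by linarith [hhi.1]
    refine ⟨n, a, b, xlo, xhi, by linarith, by linarith, hRn, haI, hbI, hab, hda2, hdb2, hlo, hhi,
      ⟨h.isDynamicalHamiltonianHopf hc hT.ne' hPp hD hxlo.ne' hlo2 hloc, ?_⟩,
      ⟨h.isDynamicalHamiltonianHopf hc hT.ne' hPp hD hxhi.ne' hhi2 hhic, ?_⟩⟩
    · exact neg_sq_mem_band (right_mem_Icc.mpr hlo.1.le) (left_mem_Icc.mpr hlo.1.le)
        (fun z hz => (hmem z).mpr (hloS z hz)) (by linarith)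
    · exact neg_sq_mem_band (left_mem_Icc.mpr hhi.2.le) (right_mem_Icc.mpr hhi.2.le)
        (fun z hz => (hmem z).mpr (hhiS z hz)) (by linarith)
  choose n a b xlo xhi hga hgb hRn ha hb hab ha2 hb2 hlo hhi hloH hhiH using key
  have hloI : ∀ g, xlo g ∈ Icc (archLeft T (n g)) (archRight T (n g)) := fun g =>
    ⟨(hb g).1.trans (hlo g).1.le, (hlo g).2.le⟩
  have hhiI : ∀ g, xhi g ∈ Icc (archLeft T (n g)) (archRight T (n g)) := fun g =>
    ⟨(hhi g).1.le, (hhi g).2.le.trans (ha g).2⟩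
  -- Concavity allows one gap per arch, so the index of the arch determines the gap.
  have huniq : ∀ g g', n g = n g' → g = g' := by
    intro g g' hn
    have ha' := ha g'
    have hb' := hb g'
    have ha2' := ha2 g'
    have hb2' := hb2 g'
    rw [← hn] at ha' hb' ha2' hb2'
    obtain ⟨e1, e2⟩ := hnear.arch_unique (hRn g) (ha g) (hb g) (hab g) (ha2 g) (hb2 g) ha' hb'
      (hab g') ha2' hb2'
    exact Subtype.ext (Prod.ext (by rw [hgb, hgb, e2]) (by rw [hga, hga, e1]))
  have hscale : ∀ {x y : ℝ}, x * (c ^ 2 - 1) = y * (c ^ 2 - 1) → x = y := fun hxy =>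
    mul_right_cancel₀ hc1.ne' hxy
  refine ⟨(R + Real.pi / T) ^ 2, fun g => xlo g * (c ^ 2 - 1), fun g => xhi g * (c ^ 2 - 1),
    fun g => ⟨?_, (hloH g).1, ?_⟩, fun g => ⟨?_, (hhiH g).1, ?_⟩,
    Function.Injective.sumElim (fun g g' hgg => ?_) (fun g g' hgg => ?_) (fun g g' hgg => ?_)⟩
  · exact mul_pos (by linarith [hRn g, (hloI g).1]) hc1
  · rw [hillParameter_I_mul hc]; exact (hloH g).2
  · exact mul_pos (by linarith [hRn g, (hhiI g).1]) hc1
  · rw [hillParameter_I_mul hc]; exact (hhiH g).2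
  · have hx := hscale hgg
    have h1 := hloI g
    rw [hx] at h1
    exact huniq g g' (arch_index_unique hT h1 (hloI g'))
  · have hx := hscale hgg
    have h1 := hhiI g
    rw [hx] at h1
    exact huniq g g' (arch_index_unique hT h1 (hhiI g'))
  -- A coincidence of the two kinds of points forces the same gap, where xhi < a < b < xlo.
  · have hx := hscale hgg
    have h1 := hloI g
    rw [hx] at h1
    obtain rfl := huniq g g' (arch_index_unique hT h1 (hhiI g'))
    linarith [(hlo g).1, (hhi g).2, hab g]
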